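/- **Setting.** Let $U,H$ be separable real Hilbert spaces, $T>0$, and $(\Omega,\mathcal F,\mathbb P,(\mathcal F_t)_{t\ge 0})$ a filtered probability space with normal filtration. Let $Q$ be a non-negative self-adjoint trace class operator on $U$ with an orthonormal basis of eigenvectors $(e_k)_{k\in\mathbb N}$ and non-increasing eigenvalues $\eta_k\ge 0$; let $\mathcal U=Q^{1/2}(U)$ with $(\varphi,\psi)_{\mathcal U}=(Q^{-1/2}\varphi,Q^{-1/2}\psi)_U$, where $Q^{-1/2}$ is the pseudo-inverse; let $\mathcal L_{HS}(\mathcal U,H)$ be the Hilbert–Schmidt operators, $\|O\|^2=\sum_k\eta_k\|Oe_k\|_H^2$. Let $W$ be a $Q$-Wiener process on $[0,T]$ with respect to $(\mathcal F_t)$ and, for $\eta_k>0$, $w_k=\eta_k^{-1/2}(W,e_k)_U$ (terms with $\eta_k=0$ below are zero). Let $A:D(A)\subset H\to H$ be densely defined and self-adjoint, with $-A$ positive definite and boundedly invertible, having eigenvalues $0<\lambda_1\le\lambda_2\le\dots$, $\lambda_n\to\infty$, and an orthonormal basis $(f_n)_{n\in\mathbb N}$ of $H$ of corresponding eigenfunctions;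 put $S(t)=e^{tA}$, $\dot H^s=D((-A)^{s/2})$, $\|v\|_{\dot H^s}=\|(-A)^{s/2}v\|_H$. **Assumptions on the equation.** Fix $\alpha\ge 1$. Let $X_0\in L^8(\Omega;\dot H^\alpha)$ be $\mathcal F_0$-measurable. Let $F:H\to H$ and $G:H\to\mathcal L_{HS}(\mathcal U,H)$ be twice Fréchet differentiable with bounded first and second derivatives, and suppose that for some $C$ and all $v\in\dot H^\alpha$, $\|F(v)\|_{\dot H^\alpha}+\|G(v)\|_{\mathcal L_{HS}(\mathcal U,\dot H^\alpha)}\le C(1+\|v\|_{\dot H^\alpha})$ and $\|G'(v)\|_{\mathcal L(\dot H^\alpha,\mathcal L_{HS}(\mathcal U,\dot H^\alpha))}\le C$. Let $X$ be the mild solution on $[0,T]$ of $dX=(AX+F(X))\,dt+G(X)\,dW$, $X(0)=X_0$, i.e. $X$ is predictable, $\sup_{t\le T}\mathbb E\|X(t)\|_H^2<\infty$, and for every $t\in[0,T]$, almost surely, $$X(t)=S(t)X_0+\int_0^tS(t-s)F(X(s))\,ds+\int_0^tS(t-s)G(X(s))\,dW(s).$$ **Schemes.** For each $N\in\mathbb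 N=\{1,2,\dots\}$ let $V_N\subset\dot H^1$ be a subspace of dimension $N$, $P_N$ the $H$-orthogonal projection onto $V_N$, and $-A_N:V_N\to V_N$ the operator with $(-A_Nv,w)_H=((-A)^{1/2}v,(-A)^{1/2}w)_H$, with $H$-orthonormal eigenbasis $(\tilde f_n)_{n\le N}$ and eigenvalues $\tilde\lambda_n>0$. Let $r$ be a rational function, without poles on $[0,\infty)$, with $r(z)=e^{-z}+\mathcal O(z^2)$ as $z\downarrow 0$, $|r(z)|<1$ for $z>0$ and $\lim_{z\to\infty}r(z)=0$. For $M,N,K\in\mathbb N$ put $\Delta t=T/M$, $t_m=m\Delta t$, $\Delta_mw_k=w_k(t_{m+1})-w_k(t_m)$, $\Delta_mW_K=\sum_{k=1}^K\sqrt{\eta_k}\,\Delta_mw_k\,e_k$ and $r(\Delta tA_N)v=\sum_{n=1}^Nr(\Delta t\tilde\lambda_n)(v,\tilde f_n)_H\tilde f_n$. The Euler scheme is $\widehat Y_0^{N,K}=P_NX_0$, $$\widehat Y_{m+1}^{N,K}=r(\Delta tA_N)\widehat Y_m^{N,K}+r(\Delta tA_N)P_NF(\widehat Y_m^{N,K})\Delta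 t+r(\Delta tA_N)P_NG(\widehat Y_m^{N,K})\Delta_mW_K ,$$ and the truncated Milstein scheme is $Y_0^{N,K}=P_NX_0$, $$Y_{m+1}^{N,K}=r(\Delta tA_N)P_N\Big(Y_m^{N,K}+F(Y_m^{N,K})\Delta t+G(Y_m^{N,K})\Delta_mW_K+\tfrac12\sum_{k,l=1}^KG'(Y_m^{N,K})\big(P_NG(Y_m^{N,K})e_l\big)e_k\,\big(\sqrt{\eta_k\eta_l}\,\Delta_mw_k\Delta_mw_l-\delta_{kl}\eta_k\Delta t\big)\Big),$$ for $m=0,\dots,M-1$. **Claim.** Suppose that the Euler scheme converges strongly with rates $\tilde\alpha,\beta>0$: there is $C>0$ such that for all $p\in(0,8]$ and all $M,N,K\in\mathbb N$, $$\max_{m=0,\dots,M}\|X(m\Delta t)-\widehat Y_m^{N,K}\|_{L^p(\Omega;H)}\le C\big(M^{-1/2}+N^{-\tilde\alpha}+K^{-\beta}\big).$$ Then the truncated Milstein scheme converges with the same rates: there is $C>0$ such that for all $p\in(0,8]$ and all $M,N,K\in\mathbb N$, $$\max_{m=0,\dots,M}\|X(m\Delta t)-Y_m^{N,K}\|_{L^p(\Omega;H)}\le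 C\big(M^{-1/2}+N^{-\tilde\alpha}+K^{-\beta}\big).$$ Here $\|Z\|_{L^p(\Omega;H)}=(\mathbb E\|Z\|_H^p)^{1/p}$. -/

import Mathlib

open MeasureTheory ProbabilityTheory Filter Topology
open scoped ENNReal NNReal

noncomputable section

namespace SPDE

/-! ### Operators that are diagonal in a Hilbert basis -/

section Diagonal

variable {E : Type*} [NormedAddCommGroup E] [InnerProductSpace ℝ E]

/-- The (possibly unbounded) diagonal operator `v ↦ ∑ₙ mₙ (v, bₙ) bₙ`, on its natural domain
`{v | ∑ₙ mₙ² (v, bₙ)² < ∞}`. -/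
def diagPMap (b : HilbertBasis ℕ ℝ E) (m : ℕ → ℝ) : E →ₗ.[ℝ] E where
  domain :=
    { carrier := {v | Memℓp (fun n => m n * inner ℝ (b n) v) 2}
      add_mem' := by
        intro v w hv hw
        have h := hv.add hw
        have e : (fun n => m n * inner ℝ (b n) (v + w)) =
            (fun n => m n * inner ℝ (b n) v) + (fun n => m n * inner ℝ (b n) w) := by
          funext n
          simp [inner_add_right, mul_add]
        simpa only [Set.mem_ofPred_eq, e] using h
      zero_mem' := by
        have e : (fun n => m n * inner ℝ (b n) (0 : E)) = 0 := by
          funext n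
          simp
        simp only [Set.mem_ofPred_eq, e]
        exact zero_memℓp
      smul_mem' := by
        intro c v hv
        have h := hv.const_smul c
        have e : (fun n => m n * inner ℝ (b n) (c • v)) =
            c • (fun n => m n * inner ℝ (b n) v) := by
          funext n
          simp [inner_smul_right]
          ring
        simpa only [Set.mem_ofPred_eq, e] using h }
  toFun :=
    { toFun := fun v => b.repr.symm ⟨fun n => m n * inner ℝ (b n) (v : E), v.2⟩
      map_add' := by
        intro v w
        rw [← map_add]
        congr 1
        ext n
        change m n * inner ℝ (b n) ((v : E) + w) = m n * inner ℝ (b n) (v : E) + m n * inner ℝ (b n) (w : E)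
        rw [inner_add_right, mul_add]
      map_smul' := by
        intro c v
        rw [RingHom.id_apply, ← map_smul]
        congr 1
        ext n
        change m n * inner ℝ (b n) (c • (v : E)) = c * (m n * inner ℝ (b n) (v : E))
        rw [inner_smul_right]
        ring }

theorem mem_diagPMap_domain (b : HilbertBasis ℕ ℝ E) (m : ℕ → ℝ) (v : E) :
    v ∈ (diagPMap b m).domain ↔ Summable fun n => (m n * inner ℝ (b n) v) ^ 2 := by
  change Memℓp (fun n => m n * inner ℝ (b n) v) 2 ↔ _
  rw [memℓp_gen_iff (by norm_num)]
  refine summable_congr fun n => ?_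
  simp [mul_pow]

theorem inner_diagPMap (b : HilbertBasis ℕ ℝ E) (m : ℕ → ℝ) (v : (diagPMap b m).domain) (n : ℕ) :
    inner ℝ (b n) (diagPMap b m v) = m n * inner ℝ (b n) (v : E) := by
  rw [← b.repr_apply_apply]
  change b.repr (b.repr.symm _) n = _
  rw [LinearIsometryEquiv.apply_symm_apply]

theorem diagPMap_domain_eq_top (b : HilbertBasis ℕ ℝ E) (m : ℕ → ℝ)
    (hm : ∃ C, ∀ n, |m n| ≤ C) (v : E) : v ∈ (diagPMap b m).domain := by
  obtain ⟨C, hC⟩ := hm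
  have h : Memℓp (fun n => inner ℝ (b n) v) 2 := by
    have h1 := (b.repr v).2
    have e : ((b.repr v : lp (fun _ : ℕ => ℝ) 2) : ℕ → ℝ) = fun n => inner ℝ (b n) v := by
      funext n
      exact b.repr_apply_apply v n
    exact e ▸ h1
  rw [mem_diagPMap_domain]
  have h2 : Summable fun n => (inner ℝ (b n) v) ^ 2 := by
    rw [memℓp_gen_iff (by norm_num)] at h
    simpa using h
  refine Summable.of_nonneg_of_le (fun n => sq_nonneg _) (fun n => ?_) (h2.mul_left (C ^ 2))
  rw [mul_pow]
  refine mul_le_mul_of_nonneg_right ?_ (sq_nonneg _)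
  exact sq_le_sq' (by linarith [neg_abs_le (m n), hC n]) ((le_abs_self _).trans (hC n))

/-- The diagonal operator `v ↦ ∑ₙ mₙ (v, bₙ) bₙ` as a bounded operator, when `m` is bounded. -/
def diagCLM (b : HilbertBasis ℕ ℝ E) (m : ℕ → ℝ) (hm : ∃ C, ∀ n, |m n| ≤ C) : E →L[ℝ] E :=
  LinearMap.mkContinuousOfExistsBound
    ((diagPMap b m).toFun.comp
      (LinearMap.codRestrict _ LinearMap.id (diagPMap_domain_eq_top b m hm))) <| by
    obtain ⟨C, hC⟩ := id hm
    refine ⟨C, fun v => ?_⟩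
    have hC0 : 0 ≤ C := (abs_nonneg _).trans (hC 0)
    set w := (LinearMap.codRestrict (diagPMap b m).domain LinearMap.id
      (diagPMap_domain_eq_top b m hm)) v with hw
    change ‖diagPMap b m w‖ ≤ C * ‖v‖
    have key : ∀ x : E, ‖x‖ ^ 2 = ∑' n, (inner ℝ (b n) x) ^ 2 := by
      intro x
      have h := b.tsum_inner_mul_inner x x
      rw [real_inner_self_eq_norm_sq] at h
      rw [← h]
      refine tsum_congr fun n => ?_
      rw [real_inner_comm, sq]
    have keys : ∀ x : E, Summable fun n => (inner ℝ (b n) x) ^ 2 := by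
      intro x
      refine (b.summable_inner_mul_inner x x).congr fun n => ?_
      rw [real_inner_comm, sq]
    have hle : ‖diagPMap b m w‖ ^ 2 ≤ (C * ‖v‖) ^ 2 := by
      rw [key, mul_pow, key v, ← tsum_mul_left]
      refine Summable.tsum_le_tsum (fun n => ?_) (keys _) ((keys v).mul_left _)
      rw [inner_diagPMap, mul_pow]
      refine mul_le_mul_of_nonneg_right ?_ (sq_nonneg _)
      exact sq_le_sq' (by linarith [neg_abs_le (m n), hC n]) ((le_abs_self _).trans (hC n))
    exact (abs_le_of_sq_le_sq' hle (by positivity)).2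

theorem inner_diagCLM (b : HilbertBasis ℕ ℝ E) (m : ℕ → ℝ) (hm : ∃ C, ∀ n, |m n| ≤ C)
    (v : E) (n : ℕ) : inner ℝ (b n) (diagCLM b m hm v) = m n * inner ℝ (b n) v :=
  inner_diagPMap b m ⟨v, diagPMap_domain_eq_top b m hm v⟩ n

theorem diagCLM_basis (b : HilbertBasis ℕ ℝ E) (m : ℕ → ℝ) (hm : ∃ C, ∀ n, |m n| ≤ C)
    (k : ℕ) : diagCLM b m hm (b k) = m k • b k := by
  apply b.repr.injective
  ext n
  rw [b.repr_apply_apply, b.repr_apply_apply, inner_diagCLM, inner_smul_right]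
  rcases eq_or_ne n k with rfl | h
  · rfl
  · rw [b.orthonormal.2 h]
    simp

end Diagonal

/-! ### The operator `A`, its semigroup and its fractional powers -/

section Operator

variable (H : Type*) [NormedAddCommGroup H] [InnerProductSpace ℝ H] [CompleteSpace H]

/-- A densely defined, self-adjoint operator `A` on `H` such that `-A` is positive definite and
boundedly invertible, together with the non-decreasing eigenvalues `ev` of `-A`, which accumulate
only at infinity, and an orthonormal basis `ef` of `H` of corresponding eigenfunctions. -/
structure EllipticOperator where
  A : H →ₗ.[ℝ] H
  dense_domain : Dense (A.domain : Set H)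
  selfAdjoint : IsSelfAdjoint A
  posDef : ∀ v : A.domain, v ≠ 0 → 0 < inner ℝ (-(A v)) (v : H)
  boundedly_invertible : ∃ R : H →L[ℝ] H,
    (∀ y : H, ∃ h : R y ∈ A.domain, A ⟨R y, h⟩ = y) ∧ ∀ v : A.domain, R (A v) = v
  ev : ℕ → ℝ
  ev_pos : ∀ n, 0 < ev n
  ev_mono : Monotone ev
  ev_tendsto : Tendsto ev atTop atTop
  ef : HilbertBasis ℕ ℝ H
  ef_mem : ∀ n, ef n ∈ A.domain
  ef_eigen : ∀ n, -(A ⟨ef n, ef_mem n⟩) = ev n • ef n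

variable {H}

namespace EllipticOperator

variable (A : EllipticOperator H)

/-- The fractional power `(-A)^θ v = ∑ₙ λₙ^θ (v, fₙ) fₙ` on its natural domain. -/
def fracPow (θ : ℝ) : H →ₗ.[ℝ] H := diagPMap A.ef fun n => A.ev n ^ θ

/-- The space `Ḣ^s = D((-A)^{s/2})`. -/
def Hdot (s : ℝ) : Submodule ℝ H := (A.fracPow (s / 2)).domain

open Classical in
/-- The norm `‖v‖_{Ḣ^s} = ‖(-A)^{s/2} v‖_H`, with the value `∞` if `v ∉ Ḣ^s`. -/
def hdotENorm (s : ℝ) (v : H) : ℝ≥0∞ :=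
  if h : v ∈ A.Hdot s then ‖A.fracPow (s / 2) ⟨v, h⟩‖ₑ else ∞

/-- The semigroup `S(t) = e^{tA}`, i.e. `S(t) v = ∑ₙ e^{-tλₙ} (v, fₙ) fₙ`. -/
def semigroup (t : ℝ≥0) : H →L[ℝ] H :=
  diagCLM A.ef (fun n => Real.exp (-((t : ℝ) * A.ev n))) ⟨1, fun n => by
    rw [abs_of_pos (Real.exp_pos _), Real.exp_le_one_iff]
    have := mul_nonneg t.2 (A.ev_pos n).le
    exact neg_nonpos.2 this⟩

end EllipticOperator

end Operator

/-! ### Covariance operators, reproducing kernel Hilbert space, Hilbert-Schmidt operators -/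

section Noise

variable (U : Type*) [NormedAddCommGroup U] [InnerProductSpace ℝ U]

/-- A non-negative, self-adjoint trace class operator `Q` on `U`, together with its non-increasing
eigenvalues `ev` (whose sum is the trace) and an orthonormal basis `ef` of eigenvectors. -/
structure Covariance where
  Q : U →L[ℝ] U
  isPositive : Q.IsPositive
  ev : ℕ → ℝ
  ev_nonneg : ∀ k, 0 ≤ ev k
  ev_anti : Antitone ev
  ev_summable : Summable ev
  ef : HilbertBasis ℕ ℝ U
  ef_eigen : ∀ k, Q (ef k) = ev k • ef k

variable {U}

namespace Covariance

variable (q : Covariance U)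

theorem sqrt_bound : ∃ C, ∀ k, |Real.sqrt (q.ev k)| ≤ C :=
  ⟨Real.sqrt (q.ev 0), fun k => by
    rw [abs_of_nonneg (Real.sqrt_nonneg _)]
    exact Real.sqrt_le_sqrt (q.ev_anti (Nat.zero_le k))⟩

/-- The square root `Q^{1/2} φ = ∑ₖ √ηₖ (φ, eₖ) eₖ`. -/
def sqrt : U →L[ℝ] U :=
  diagCLM q.ef (fun k => Real.sqrt (q.ev k)) q.sqrt_bound

/-- The set `Q^{1/2}(U)`, as a subspace of `U`. -/
def rangeSqrt : Submodule ℝ U := LinearMap.range (q.sqrt : U →ₗ[ℝ] U)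

/-- The kernel of `Q^{1/2}`. -/
def kerSqrt : Submodule ℝ U := LinearMap.ker (q.sqrt : U →ₗ[ℝ] U)

/-- `Q^{1/2}` as a surjection from `U` onto its range. -/
def sqrtRange : U →ₗ[ℝ] q.rangeSqrt := (q.sqrt : U →ₗ[ℝ] U).rangeRestrict

theorem coe_sqrtRange (v : U) : (q.sqrtRange v : U) = q.sqrt v := rfl

theorem sqrtRange_surjective : Function.Surjective q.sqrtRange :=
  (q.sqrt : U →ₗ[ℝ] U).surjective_rangeRestrict

variable [CompleteSpace U]

theorem sqrtRange_bijective : Function.Bijective (q.sqrtRange.comp q.kerSqrtᗮ.subtype) := by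
  have hcl : IsClosed (q.kerSqrt : Set U) := q.sqrt.isClosed_ker
  have : CompleteSpace q.kerSqrt := hcl.completeSpace_coe
  constructor
  · rw [injective_iff_map_eq_zero]
    rintro ⟨v, hv⟩ h
    have hk : v ∈ q.kerSqrt := congrArg Subtype.val h
    exact Subtype.ext (inner_self_eq_zero.1 (hv v hk))
  · intro φ
    obtain ⟨v, rfl⟩ := q.sqrtRange_surjective φ
    obtain ⟨y, hy, z, hz, rfl⟩ := q.kerSqrt.exists_add_mem_mem_orthogonal v
    refine ⟨⟨z, hz⟩, Subtype.ext ?_⟩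
    have h0 : q.sqrt y = 0 := hy
    simp [coe_sqrtRange, h0]

/-- The pseudo-inverse `Q^{-1/2}`: the preimage orthogonal to the kernel of `Q^{1/2}`, i.e. the
one of minimal norm (`norm_pinv_le`). -/
def pinv : q.rangeSqrt →ₗ[ℝ] U :=
  q.kerSqrtᗮ.subtype.comp (LinearEquiv.ofBijective _ q.sqrtRange_bijective).symm.toLinearMap

theorem sqrtRange_pinv (φ : q.rangeSqrt) : q.sqrtRange (q.pinv φ) = φ :=
  (LinearEquiv.ofBijective _ q.sqrtRange_bijective).apply_symm_apply φ

theorem pinv_injective : Function.Injective q.pinv :=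
  Function.LeftInverse.injective q.sqrtRange_pinv

theorem pinv_mem (φ : q.rangeSqrt) : q.pinv φ ∈ q.kerSqrtᗮ :=
  ((LinearEquiv.ofBijective _ q.sqrtRange_bijective).symm φ).2

theorem norm_pinv_le (v : U) : ‖q.pinv (q.sqrtRange v)‖ ≤ ‖v‖ := by
  set w := q.pinv (q.sqrtRange v) with hw
  have hker : v - w ∈ q.kerSqrt := by
    have h1 : q.sqrtRange (v - w) = 0 := by rw [map_sub, hw, sqrtRange_pinv, sub_self]
    exact congrArg Subtype.val h1
  have horth : inner ℝ (v - w) w = 0 := q.pinv_mem _ _ hker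
  have hsq : ‖v‖ * ‖v‖ = ‖v - w‖ * ‖v - w‖ + ‖w‖ * ‖w‖ := by
    have := norm_add_sq_eq_norm_sq_add_norm_sq_of_inner_eq_zero (v - w) w horth
    simpa using this
  nlinarith [norm_nonneg v, norm_nonneg w, mul_self_nonneg ‖v - w‖]

/-- The reproducing kernel Hilbert space `𝒰`: the set `Q^{1/2}(U)` with the scalar product
`(φ, ψ)_𝒰 = (Q^{-1/2} φ, Q^{-1/2} ψ)_U`. -/
def RKHS : Type _ := q.rangeSqrt

instance : NormedAddCommGroup q.RKHS :=
  NormedAddCommGroup.induced q.rangeSqrt U q.pinv q.pinv_injective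

instance : InnerProductSpace ℝ q.RKHS :=
  InnerProductSpace.induced (G := q.rangeSqrt) q.pinv

theorem RKHS.inner_def (φ ψ : q.RKHS) : inner ℝ φ ψ = inner ℝ (q.pinv φ) (q.pinv ψ) := rfl

theorem RKHS.norm_def (φ : q.RKHS) : ‖φ‖ = ‖q.pinv φ‖ := rfl

/-- `Q^{1/2}` as a map from `U` to `𝒰`. -/
def toRKHS : U →ₗ[ℝ] q.RKHS := q.sqrtRange

/-- The inclusion of `𝒰` into `U`, as a linear map. -/
def inclₗ : q.RKHS →ₗ[ℝ] U := q.rangeSqrt.subtype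

/-- The continuous inclusion of `𝒰` into `U`. -/
def incl : q.RKHS →L[ℝ] U :=
  q.inclₗ.mkContinuous ‖q.sqrt‖ fun φ => by
    have h : q.inclₗ φ = q.sqrt (q.pinv φ) := (congrArg Subtype.val (q.sqrtRange_pinv φ)).symm
    rw [h]
    exact q.sqrt.le_opNorm _

/-- The vector `√ηₖ eₖ = Q^{1/2} eₖ` of `𝒰`. Those with `ηₖ > 0`
form an orthonormal basis of it, the others vanish. -/
def basisVec (k : ℕ) : q.RKHS := q.toRKHS (q.ef k)

theorem incl_basisVec (k : ℕ) : q.incl (q.basisVec k) = Real.sqrt (q.ev k) • q.ef k :=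
  diagCLM_basis q.ef (fun k => Real.sqrt (q.ev k)) q.sqrt_bound k

variable (H : Type*) [NormedAddCommGroup H] [InnerProductSpace ℝ H]

/-- The set of Hilbert-Schmidt operators `𝒰 → H` on the reproducing kernel Hilbert space `𝒰`, i.e.
of bounded operators `O` with `∑ₖ ‖O (√ηₖ eₖ)‖² < ∞`. -/
def hsSubmodule : Submodule ℝ (q.RKHS →L[ℝ] H) where
  carrier := {O | Memℓp (fun k => O (q.basisVec k)) 2}
  add_mem' := fun h₁ h₂ => h₁.add h₂
  zero_mem' := zero_memℓp
  smul_mem' := fun c _ h => h.const_smul c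

variable {H}

/-- The sequence `(O (√ηₖ eₖ))ₖ` of a Hilbert-Schmidt operator `O`. -/
def hsToLp : q.hsSubmodule H →ₗ[ℝ] lp (fun _ : ℕ => H) 2 where
  toFun O := ⟨fun k => (O : q.RKHS →L[ℝ] H) (q.basisVec k), O.2⟩
  map_add' _ _ := rfl
  map_smul' _ _ := rfl

/-- Bounded operators on `𝒰` are determined by their values at the `√ηₖ eₖ`. -/
theorem RKHS.clm_eq_zero {O : q.RKHS →L[ℝ] H} (h : ∀ k, O (q.basisVec k) = 0) : O = 0 := by
  let j : U →L[ℝ] q.RKHS := q.toRKHS.mkContinuous 1 fun v => by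
    rw [one_mul, RKHS.norm_def]
    exact q.norm_pinv_le v
  have hj : O.comp j = 0 := by
    refine ContinuousLinearMap.ext_on (s := Set.range q.ef) ?_ ?_
    · exact Submodule.dense_iff_topologicalClosure_eq_top.2 q.ef.dense_span
    · rintro _ ⟨k, rfl⟩
      exact h k
  ext φ
  obtain ⟨v, rfl⟩ : ∃ v, q.toRKHS v = φ := q.sqrtRange_surjective φ
  exact congrArg (fun B : U →L[ℝ] H => B v) hj

theorem hsToLp_injective : Function.Injective (q.hsToLp : q.hsSubmodule H →ₗ[ℝ] _) := by
  rw [injective_iff_map_eq_zero]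
  intro O hO
  refine Subtype.ext (RKHS.clm_eq_zero q fun k => ?_)
  exact congrArg (fun x : lp (fun _ : ℕ => H) 2 => x k) hO

variable (H)

/-- The space `ℒ_HS(𝒰, H)` of Hilbert-Schmidt operators; its norm is the Hilbert-Schmidt norm. -/
def HS : Type _ := q.hsSubmodule H

instance : NormedAddCommGroup (q.HS H) :=
  NormedAddCommGroup.induced (q.hsSubmodule H) (lp (fun _ : ℕ => H) 2) q.hsToLp q.hsToLp_injective

instance : InnerProductSpace ℝ (q.HS H) :=
  InnerProductSpace.induced (G := q.hsSubmodule H) q.hsToLp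

variable {H}

/-- A Hilbert-Schmidt operator as a bounded operator. -/
def HS.toCLM : q.HS H →ₗ[ℝ] (q.RKHS →L[ℝ] H) := (q.hsSubmodule H).subtype

instance : CoeFun (q.HS H) fun _ => q.RKHS → H := ⟨fun O => HS.toCLM q O⟩

/-- The Hilbert-Schmidt norm: `‖O‖² = ∑ₖ ‖O (√ηₖ eₖ)‖² = ∑ₖ ηₖ ‖O eₖ‖²`. -/
theorem HS.norm_sq (O : q.HS H) : ‖O‖ ^ 2 = ∑' k, ‖O (q.basisVec k)‖ ^ 2 := by
  have h := lp.norm_rpow_eq_tsum (p := 2) (by norm_num) (q.hsToLp O)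
  have e : ‖O‖ = ‖q.hsToLp O‖ := rfl
  rw [e]
  have h2 : ‖q.hsToLp O‖ ^ 2 = ∑' k, ‖q.hsToLp O k‖ ^ 2 := by simpa using h
  exact h2

/-- The squared Hilbert-Schmidt norm of a bounded operator `𝒰 → H`, possibly infinite. -/
def hsENormSq (O : q.RKHS →L[ℝ] H) : ℝ≥0∞ := ∑' k, ‖O (q.basisVec k)‖ₑ ^ 2

/-- The Hilbert-Schmidt norm of an operator `𝒰 → Ḣ^s`, with the value `∞` if this operator is not
Hilbert-Schmidt into `Ḣ^s`. -/
def hsHdotENorm [CompleteSpace H] (A : EllipticOperator H) (s : ℝ) (O : q.HS H) : ℝ≥0∞ :=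
  (∑' k, A.hdotENorm s (O (q.basisVec k)) ^ 2) ^ (1 / 2 : ℝ)

end Covariance

end Noise

/-! ### Filtrations, Wiener processes, the Itô integral -/

section Stochastic

variable {Ω : Type*} {mΩ : MeasurableSpace Ω}

/-- A normal filtration: right-continuous, and `𝓕₀` contains all null sets. -/
structure IsNormalFiltration (𝓕 : Filtration ℝ≥0 mΩ) (P : Measure Ω) : Prop where
  rightContinuous : 𝓕.IsRightContinuous
  null_mem : ∀ B, MeasurableSet B → P B = 0 → MeasurableSet[𝓕 0] B

variable {U : Type*} [NormedAddCommGroup U] [InnerProductSpace ℝ U]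

/-- `W` is a `Q`-Wiener process on `[0, T]` with respect to the filtration `𝓕`. A `U`-valued random
variable has law `𝒩(0, c Q)` iff its scalar product with any `u` has law `𝒩(0, c (Q u, u))`. -/
structure IsWiener [MeasurableSpace U] (q : Covariance U) (𝓕 : Filtration ℝ≥0 mΩ) (P : Measure Ω)
    (T : ℝ≥0) (W : ℝ≥0 → Ω → U) : Prop where
  zero : ∀ᵐ ω ∂P, W 0 ω = 0
  continuous_paths : ∀ᵐ ω ∂P, ContinuousOn (fun t => W t ω) (Set.Icc 0 T)
  adapted : ∀ t ≤ T, StronglyMeasurable[𝓕 t] (W t)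
  indep : ∀ s t, s ≤ t → t ≤ T →
    Indep (MeasurableSpace.comap (fun ω => W t ω - W s ω) inferInstance) (𝓕 s) P
  gaussian : ∀ s t, s ≤ t → t ≤ T → ∀ u : U,
    P.map (fun ω => inner ℝ u (W t ω - W s ω)) =
      gaussianReal 0 (((t : ℝ) - s) * inner ℝ (q.Q u) u).toNNReal

variable (U)
variable (H : Type*) [NormedAddCommGroup H] [InnerProductSpace ℝ H]

/-- An elementary process `∑ᵢ 1_{(sᵢ, tᵢ] × Bᵢ} Oᵢ` with `Bᵢ ∈ 𝓕_{sᵢ}` and `Oᵢ ∈ ℒ(U, H)`. -/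
structure ElementaryProcess (𝓕 : Filtration ℝ≥0 mΩ) where
  n : ℕ
  left : Fin n → ℝ≥0
  right : Fin n → ℝ≥0
  left_le_right : ∀ i, left i ≤ right i
  event : Fin n → Set Ω
  event_mem : ∀ i, MeasurableSet[𝓕 (left i)] (event i)
  op : Fin n → U →L[ℝ] H

variable {U H}

namespace ElementaryProcess

variable {𝓕 : Filtration ℝ≥0 mΩ}

/-- The value of an elementary process at time `s`. -/
def value (Ψ : ElementaryProcess U H 𝓕) (s : ℝ≥0) (ω : Ω) : U →L[ℝ] H :=
  ∑ i, (Set.Ioc (Ψ.left i) (Ψ.right i) ×ˢ Ψ.event i).indicator (fun _ => Ψ.op i) (s, ω)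

/-- The stochastic integral `∫₀ᵗ Ψ dW` of an elementary process. -/
def integral (Ψ : ElementaryProcess U H 𝓕) (W : ℝ≥0 → Ω → U) (t : ℝ≥0) (ω : Ω) : H :=
  ∑ i, (Ψ.event i).indicator
    (fun ω => Ψ.op i (W (min (Ψ.right i) t) ω - W (min (Ψ.left i) t) ω)) ω

end ElementaryProcess

/-- `I` is the Itô integral `∫₀ᵗ Φ dW` of the predictable integrand `Φ`: there are elementary
processes `Ψₙ` with `E ∫₀ᵗ ‖Ψₙ(s) - Φ(s)‖²_{HS} ds → 0`, and `∫₀ᵗ Ψₙ dW → I` in `L²(Ω; H)`. -/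
def IsItoIntegral [CompleteSpace U] (q : Covariance U) (𝓕 : Filtration ℝ≥0 mΩ) (P : Measure Ω)
    (W : ℝ≥0 → Ω → U) (Φ : ℝ≥0 → Ω → q.RKHS →L[ℝ] H) (t : ℝ≥0) (I : Ω → H) : Prop :=
  (∀ φ : q.RKHS, IsStronglyPredictable 𝓕 fun s ω => Φ s ω φ) ∧
  MemLp I 2 P ∧
  ∃ Ψ : ℕ → ElementaryProcess U H 𝓕,
    Tendsto (fun n => ∫⁻ ω, (∫⁻ s in Set.Icc (0 : ℝ) t,
      q.hsENormSq (((Ψ n).value s.toNNReal ω).comp q.incl - Φ s.toNNReal ω)) ∂P) atTop (𝓝 0) ∧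
    Tendsto (fun n => eLpNorm (fun ω => (Ψ n).integral W t ω - I ω) 2 P) atTop (𝓝 0)

variable [CompleteSpace H]

/-- `X` is a mild solution on `[0, T]` of `dX = (A X + F(X)) dt + G(X) dW`, `X(0) = X₀`:
a predictable process with `sup_t E ‖X(t)‖² < ∞` such that, for all `t ≤ T`, almost surely
`X(t) = S(t) X₀ + ∫₀ᵗ S(t-s) F(X(s)) ds + ∫₀ᵗ S(t-s) G(X(s)) dW(s)`.
(Values `X(t)` for `t > T` are irrelevant.) -/
structure IsMildSolution [CompleteSpace U] (A : EllipticOperator H) (q : Covariance U)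
    (𝓕 : Filtration ℝ≥0 mΩ) (P : Measure Ω) (T : ℝ≥0) (W : ℝ≥0 → Ω → U)
    (X₀ : Ω → H) (F : H → H) (G : H → q.HS H) (X : ℝ≥0 → Ω → H) : Prop where
  predictable : IsStronglyPredictable 𝓕 X
  bounded : ∃ C : ℝ≥0, ∀ t ≤ T, ∫⁻ ω, ‖X t ω‖ₑ ^ 2 ∂P ≤ C
  mild : ∀ t ≤ T, ∃ I : Ω → H,
    IsItoIntegral q 𝓕 P W
      (fun s ω => (A.semigroup (t - s)).comp (Covariance.HS.toCLM q (G (X s ω)))) t I ∧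
    ∀ᵐ ω ∂P, X t ω = A.semigroup t (X₀ ω) +
      (∫ s in (0 : ℝ)..t, A.semigroup (t - s.toNNReal) (F (X s.toNNReal ω))) + I ω

/-- The assumptions on the coefficients: `F : H → H` and `G : H → ℒ_HS(𝒰, H)` are twice Fréchet
differentiable with bounded derivatives, and satisfy growth bounds with respect to `Ḣ^α`. -/
structure CoefficientAssumption [CompleteSpace U] (A : EllipticOperator H) (q : Covariance U)
    (α : ℝ) (F : H → H) (G : H → q.HS H) : Prop where
  F_diff : Differentiable ℝ F
  F_diff₂ : Differentiable ℝ (fderiv ℝ F)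
  F_bound : ∃ C : ℝ, ∀ v, ‖fderiv ℝ F v‖ + ‖fderiv ℝ (fderiv ℝ F) v‖ ≤ C
  G_diff : Differentiable ℝ G
  G_diff₂ : Differentiable ℝ (fderiv ℝ G)
  G_bound : ∃ C : ℝ, ∀ v, ‖fderiv ℝ G v‖ + ‖fderiv ℝ (fderiv ℝ G) v‖ ≤ C
  growth : ∃ C : ℝ≥0, ∀ v ∈ A.Hdot α,
    A.hdotENorm α (F v) + q.hsHdotENorm A α (G v) ≤ C * (1 + A.hdotENorm α v)
  deriv_growth : ∃ C : ℝ≥0, ∀ v ∈ A.Hdot α, ∀ w ∈ A.Hdot α,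
    q.hsHdotENorm A α (fderiv ℝ G v w) ≤ C * A.hdotENorm α w

end Stochastic

/-! ### Spatial discretization and rational approximation -/

section Discretization

variable {H : Type*} [NormedAddCommGroup H] [InnerProductSpace ℝ H] [CompleteSpace H]

/-- An `N`-dimensional subspace `V_N` of `V = Ḣ¹`. -/
structure GalerkinSpace (A : EllipticOperator H) (N : ℕ) where
  space : Submodule ℝ H
  le_Hdot : space ≤ A.Hdot 1
  finiteDimensional : FiniteDimensional ℝ space
  finrank_eq : Module.finrank ℝ space = N

attribute [instance] GalerkinSpace.finiteDimensional

namespace GalerkinSpace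

variable {A : EllipticOperator H} {N : ℕ} (V : GalerkinSpace A N)

/-- The restriction of `(-A)^{1/2}` to `V_N`. -/
def sqrtNegA : V.space →L[ℝ] H :=
  LinearMap.toContinuousLinearMap
    ((A.fracPow (1 / 2)).toFun.comp (Submodule.inclusion V.le_Hdot))

/-- The discrete operator `-A_N : V_N → V_N`, given by
`(-A_N v, w)_H = B(v, w) = ((-A)^{1/2} v, (-A)^{1/2} w)_H`. -/
def negDiscrete : V.space →ₗ[ℝ] V.space :=
  ((ContinuousLinearMap.adjoint V.sqrtNegA).comp V.sqrtNegA : V.space →L[ℝ] V.space)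

theorem inner_negDiscrete (v w : V.space) :
    inner ℝ (V.negDiscrete v) w = inner ℝ (A.fracPow (1 / 2) ⟨v, V.le_Hdot v.2⟩)
      (A.fracPow (1 / 2) ⟨w, V.le_Hdot w.2⟩) :=
  ContinuousLinearMap.adjoint_inner_left V.sqrtNegA w (V.sqrtNegA v)

theorem negDiscrete_isSymmetric : V.negDiscrete.IsSymmetric := by
  intro v w
  rw [inner_negDiscrete, real_inner_comm, ← inner_negDiscrete, real_inner_comm]

/-- The eigenvalues of `-A_N`. -/
def ev (n : Fin N) : ℝ := V.negDiscrete_isSymmetric.eigenvalues V.finrank_eq n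

/-- An orthonormal basis of `V_N` of eigenvectors of `-A_N`. -/
def ef (n : Fin N) : H := V.negDiscrete_isSymmetric.eigenvectorBasis V.finrank_eq n

/-- The `H`-orthogonal projection `P_N` onto `V_N`. -/
def proj : H →L[ℝ] H := V.space.starProjection

/-- The rational approximation `r(Δt A_N) v = ∑ₙ r(Δt λ̃ₙ) (v, f̃ₙ) f̃ₙ` of `exp(Δt A_N) P_N`. -/
def ratApprox (r : ℝ → ℝ) (Δt : ℝ) (v : H) : H :=
  ∑ n, (r (Δt * V.ev n) * inner ℝ v (V.ef n)) • V.ef n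

end GalerkinSpace

/-- `r` is a rational function (without poles in `[0, ∞)`) such that `r(z) = e^{-z} + O(z²)` as
`z → 0`, `|r(z)| < 1` for `z > 0` and `r(z) → 0` as `z → ∞`. Only its values on `[0, ∞)` matter. -/
structure IsStableRational (r : ℝ → ℝ) : Prop where
  rational : ∃ p d : Polynomial ℝ, ∀ z, 0 ≤ z → d.eval z ≠ 0 ∧ r z = p.eval z / d.eval z
  order : (fun z => r z - Real.exp (-z)) =O[𝓝[>] 0] fun z => z ^ 2
  abs_lt_one : ∀ z, 0 < z → |r z| < 1
  tendsto_zero : Tendsto r atTop (𝓝 0)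

end Discretization

/-! ### The fully discrete schemes -/

section Schemes

variable {Ω : Type*} {U : Type*} [NormedAddCommGroup U] [InnerProductSpace ℝ U]

/-- The grid point `t_m = m T / M`. -/
def grid (T : ℝ≥0) (M m : ℕ) : ℝ≥0 := m * (T / M)

/-- The increment `Δ_m wₖ` over `[t_m, t_{m+1}]` of the Brownian motion
`wₖ = ηₖ^{-1/2} (W, eₖ)_U` (it is set to zero if `ηₖ = 0`). -/
def brownianIncrement (q : Covariance U) (W : ℝ≥0 → Ω → U) (T : ℝ≥0) (M m k : ℕ) (ω : Ω) : ℝ :=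
  (Real.sqrt (q.ev k))⁻¹ * inner ℝ (W (grid T M (m + 1)) ω - W (grid T M m) ω) (q.ef k)

variable [CompleteSpace U]

/-- The increment `Δ_m W_K = ∑_{k ≤ K} Δ_m wₖ √ηₖ eₖ` of the truncated noise (the first `K`
eigenvectors are those of index `0, …, K - 1`), as an element of the space `𝒰`. -/
def noiseIncrement (q : Covariance U) (W : ℝ≥0 → Ω → U) (T : ℝ≥0) (M K m : ℕ) (ω : Ω) : q.RKHS :=
  ∑ k ∈ Finset.range K, brownianIncrement q W T M m k ω • q.basisVec k

variable {H : Type*} [NormedAddCommGroup H] [InnerProductSpace ℝ H] [CompleteSpace H]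
  {A : EllipticOperator H} {N : ℕ}

/-- The truncated Milstein correction `𝒢(Y) Δ_m 𝒲_{m,K}`, i.e.
`1/2 ∑_{k,l ≤ K} G'(Y)(P_N G(Y) eₗ) eₖ (√(ηₖ ηₗ) Δ_m wₖ Δ_m wₗ - δ_{kl} ηₖ Δt)`. -/
def milsteinCorrection (q : Covariance U) (G : H → q.HS H) (V : GalerkinSpace A N)
    (W : ℝ≥0 → Ω → U) (T : ℝ≥0) (M K m : ℕ) (y : H) (ω : Ω) : H :=
  (1 / 2 : ℝ) • ∑ k ∈ Finset.range K, ∑ l ∈ Finset.range K,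
    (brownianIncrement q W T M m k ω * brownianIncrement q W T M m l ω -
        if k = l then (T : ℝ) / M else 0) •
      (fderiv ℝ G y (V.proj (G y (q.basisVec l)))) (q.basisVec k)

/-- The Euler scheme `Ŷ_m^{N,K}`. -/
def euler (q : Covariance U) (F : H → H) (G : H → q.HS H) (V : GalerkinSpace A N) (r : ℝ → ℝ)
    (W : ℝ≥0 → Ω → U) (X₀ : Ω → H) (T : ℝ≥0) (M K : ℕ) : ℕ → Ω → H
  | 0, ω => V.proj (X₀ ω)
  | m + 1, ω =>
    let y := euler q F G V r W X₀ T M K m ω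
    V.ratApprox r (T / M) y + V.ratApprox r (T / M) (V.proj (((T : ℝ) / M) • F y)) +
      V.ratApprox r (T / M) (V.proj (G y (noiseIncrement q W T M K m ω)))

/-- The truncated Milstein scheme `Y_m^{N,K}`. -/
def milstein (q : Covariance U) (F : H → H) (G : H → q.HS H) (V : GalerkinSpace A N) (r : ℝ → ℝ)
    (W : ℝ≥0 → Ω → U) (X₀ : Ω → H) (T : ℝ≥0) (M K : ℕ) : ℕ → Ω → H
  | 0, ω => V.proj (X₀ ω)
  | m + 1, ω =>
    let y := milstein q F G V r W X₀ T M K m ω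
    V.ratApprox r (T / M) (V.proj (y + ((T : ℝ) / M) • F y +
      G y (noiseIncrement q W T M K m ω) + milsteinCorrection q G V W T M K m y ω))

end Schemes

/-- The strong error estimate: for all `p ∈ (0, 8]`, all `M, N, K ≥ 1` and all `m ≤ M`,
`‖X(mΔt) - Z_m^{M,N,K}‖_{L^p(Ω; H)} ≤ C (M^{-1/2} + N^{-a} + K^{-β})`, for approximations
`Z M N K m` of `X(m T / M)`. -/
def StrongErrorBound {Ω H : Type*} [NormedAddCommGroup H] {mΩ : MeasurableSpace Ω} (P : Measure Ω)
    (T : ℝ≥0) (X : ℝ≥0 → Ω → H) (Z : ℕ → ℕ → ℕ → ℕ → Ω → H) (C a β : ℝ) : Prop :=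
  ∀ p : ℝ, 0 < p → p ≤ 8 → ∀ M N K : ℕ, 1 ≤ M → 1 ≤ N → 1 ≤ K → ∀ m ≤ M,
    eLpNorm (fun ω => X (grid T M m) ω - Z M N K m ω) (ENNReal.ofReal p) P ≤
      ENNReal.ofReal (C * ((M : ℝ) ^ (-(1 / 2) : ℝ) + (N : ℝ) ^ (-a) + (K : ℝ) ^ (-β)))

end SPDE

end

/-!
The truncated Milstein scheme is compared with the Euler scheme, not with the mild solution: the two
schemes differ by `O(M^{-1/2})` in `L⁸(Ω; H)`, uniformly in `N` and `K`
(`exists_milstein_sub_euler_bound`), and the assumed error bound of the Euler scheme does the rest.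

The difference `D_m` of the schemes satisfies
`D_{m+1} = r(Δt A_N) (D_m + Δt f_m + g_m + c_m)` with Lipschitz differences `f_m`, `g_m` of drift and
noise and the Milstein correction `c_m`, and `r(Δt A_N)` is a contraction. Given the past, `g_m + c_m`
is a centred Gaussian chaos of order two. Centred perturbations enter the squared norm only through
their variance: `‖x + ξ‖²_{L⁸} ≤ ‖x‖² + C ‖ξ‖²`, as the first order term of `‖x + ξ‖⁸` vanishes in
expectation (`norm_add_pow_eight_le`, `exists_isSmoothnessConst`). Adding the Gaussian coordinates one
at a time, this bounds the eighth moment of a chaos by its Hilbert-Schmidt size, independently of the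
number `K` of coordinates (`lfour_chaos_le`); no Burkholder inequality is needed. As the correction is
of order `Δt`, the squared `L⁸` norms `d_m` of `D_m` and `u_m` of the Milstein scheme satisfy
`d_{m+1} ≤ (1 + B Δt) d_m + B Δt² (1 + u_m)` and `u_{m+1} ≤ u_m + B Δt (1 + u_m)`, whence
`d_m = O(Δt)` by Gronwall's lemma.

The squared `L⁸` norm is the norm in `L⁴` of the squared norm of `H` (`lfour`), for which the triangle
inequality is available. It is defined by a lower integral, so that no moment has to be known to be
finite beforehand, apart from the one of the initial value.
-/

noncomputable section

namespace SPDE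

/-! ### Eighth moments of a Gaussian perturbation -/

section Smoothness

variable {H : Type*} [NormedAddCommGroup H] [InnerProductSpace ℝ H]

theorem enorm_sq {E : Type*} [SeminormedAddGroup E] (v : E) :
    ‖v‖ₑ ^ 2 = ENNReal.ofReal (‖v‖ ^ 2) := by
  rw [← ofReal_norm, ENNReal.ofReal_pow (norm_nonneg _)]

/-- Second order Taylor bound for `‖·‖⁸`. The first order term is kept exactly, because it vanishes
in expectation when `y` is centred. -/
theorem norm_add_pow_eight_le (x y : H) :
    ‖x + y‖ ^ 8 ≤ ‖x‖ ^ 8 + 8 * ‖x‖ ^ 6 * inner ℝ x y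
      + 500 * (‖x‖ ^ 6 * ‖y‖ ^ 2 + (‖y‖ ^ 2) ^ 4) := by
  have h1 : ‖x + y‖ ^ 2 = ‖x‖ ^ 2 + 2 * inner ℝ x y + ‖y‖ ^ 2 := norm_add_sq_real x y
  have h2 : |inner ℝ x y| ≤ ‖x‖ * ‖y‖ := abs_real_inner_le_norm x y
  have e8 : ‖x + y‖ ^ 8 = (‖x + y‖ ^ 2) ^ 4 := by ring
  rw [e8, h1]
  have ha := norm_nonneg x
  have hb := norm_nonneg y
  generalize ‖x‖ = a at *
  generalize ‖y‖ = b at *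
  generalize inner ℝ x y = t at *
  -- `‖x + y‖² = a² + w`; expand `(a² + w)⁴` around `a²`.
  obtain ⟨w, hw⟩ : ∃ w, w = 2 * t + b ^ 2 := ⟨_, rfl⟩
  have hw1 : |w| ≤ b * (2 * a + b) := by
    rw [abs_le] at h2 ⊢
    constructor <;> nlinarith [sq_nonneg b]
  have hw2 : w ^ 2 ≤ b ^ 2 * (8 * a ^ 2 + 2 * b ^ 2) := by
    have : w ^ 2 ≤ (b * (2 * a + b)) ^ 2 := sq_le_sq' (abs_le.1 hw1).1 (abs_le.1 hw1).2
    nlinarith [mul_nonneg (sq_nonneg b) (sq_nonneg (2 * a - b))]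
  have hw4 : w ^ 4 ≤ b ^ 4 * (128 * a ^ 4 + 8 * b ^ 4) := by
    have h3 : (w ^ 2) ^ 2 ≤ (b ^ 2 * (8 * a ^ 2 + 2 * b ^ 2)) ^ 2 :=
      pow_le_pow_left₀ (sq_nonneg w) hw2 2
    nlinarith [mul_nonneg (pow_nonneg hb 4) (sq_nonneg (8 * a ^ 2 - 2 * b ^ 2))]
  have hw3 : 4 * a ^ 2 * w ^ 3 ≤ 2 * a ^ 4 * w ^ 2 + 2 * w ^ 4 := by
    nlinarith [mul_nonneg (sq_nonneg w) (sq_nonneg (a ^ 2 - w))]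
  have hab : a ^ 4 * b ^ 4 ≤ a ^ 6 * b ^ 2 + b ^ 8 := by
    rcases le_total a b with h | h
    · have : a ^ 4 * b ^ 4 ≤ b ^ 4 * b ^ 4 := by gcongr
      have h8 : 0 ≤ a ^ 6 * b ^ 2 := by positivity
      nlinarith
    · have : b ^ 2 * a ^ 4 * b ^ 2 ≤ b ^ 2 * a ^ 4 * a ^ 2 := by gcongr
      have h8 : 0 ≤ b ^ 8 := by positivity
      nlinarith
  have ha4 : a ^ 4 * w ^ 2 ≤ 8 * (a ^ 6 * b ^ 2) + 2 * (a ^ 4 * b ^ 4) := by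
    have := mul_le_mul_of_nonneg_left hw2 (pow_nonneg ha 4)
    nlinarith
  have p1 : 0 ≤ a ^ 6 * b ^ 2 := by positivity
  have p2 : 0 ≤ b ^ 8 := by positivity
  have ew : a ^ 2 + 2 * t + b ^ 2 = a ^ 2 + w := by rw [hw]; ring
  have et : 8 * a ^ 6 * t = 4 * a ^ 6 * w - 4 * (a ^ 6 * b ^ 2) := by rw [hw]; ring
  rw [ew, et]
  have eb : (b ^ 2) ^ 4 = b ^ 8 := by ring
  have hw4' : w ^ 4 ≤ 128 * (a ^ 4 * b ^ 4) + 8 * b ^ 8 := by nlinarith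
  have e4 : (a ^ 2 + w) ^ 4 =
      a ^ 8 + 4 * a ^ 6 * w + 6 * (a ^ 4 * w ^ 2) + 4 * a ^ 2 * w ^ 3 + w ^ 4 := by ring
  rw [eb, e4]
  linarith

theorem integrable_pow_gaussianReal (n : ℕ) :
    Integrable (fun g : ℝ => g ^ n) (gaussianReal 0 1) := by
  rcases Nat.eq_zero_or_pos n with rfl | hn
  · simp
  · have h := (memLp_id_gaussianReal' (μ := 0) (v := 1) (n : ℝ≥0∞) (by simp)).integrable_norm_pow
      hn.ne'
    refine h.mono' (by fun_prop) (ae_of_all _ fun g => ?_)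
    simp

theorem integral_sq_gaussianReal : ∫ g, g ^ 2 ∂(gaussianReal 0 1) = 1 := by
  have h := variance_fun_id_gaussianReal (μ := 0) (v := 1)
  rw [variance_eq_integral (by fun_prop)] at h
  simpa using h

/-- `C` is a constant with which `ξ = g z + (g² - 1) c`, for a standard Gaussian variable `g`,
satisfies `‖x + ξ‖²_{L⁸} ≤ ‖x‖² + C (‖z‖² + ‖c‖²)`: since `ξ` is centred, its second order size
enters, and not the first. The eighth power of the `L⁸` norm is written as `(‖·‖²)⁴`. -/
structure IsSmoothnessConst (H : Type*) [NormedAddCommGroup H] [InnerProductSpace ℝ H]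
    (C : ℝ≥0) : Prop where
  one_le : 1 ≤ C
  bound : ∀ x z c : H, ∫⁻ g, (‖x + g • z + (g ^ 2 - 1) • c‖ₑ ^ 2) ^ 4 ∂(gaussianReal 0 1) ≤
    (‖x‖ₑ ^ 2 + C * (‖z‖ₑ ^ 2 + ‖c‖ₑ ^ 2)) ^ 4

theorem exists_isSmoothnessConst (H : Type*) [NormedAddCommGroup H] [InnerProductSpace ℝ H] :
    ∃ C : ℝ≥0, IsSmoothnessConst H C := by
  set γ := gaussianReal 0 1
  set m4 := ∫ g, g ^ 4 ∂γ with hm4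
  set m16 := ∫ g, g ^ 16 ∂γ with hm16
  have hm4n : 0 ≤ m4 := integral_nonneg fun g => by positivity
  have hm16n : 0 ≤ m16 := integral_nonneg fun g => by positivity
  set D : ℝ := 64000 * (m4 + m16 + 1) with hD
  have hD1 : 1 ≤ D := by rw [hD]; linarith
  refine ⟨D.toNNReal, Real.one_le_toNNReal.2 hD1, fun x z c => ?_⟩
  obtain ⟨s, hs⟩ : ∃ s, s = ‖z‖ ^ 2 + ‖c‖ ^ 2 := ⟨_, rfl⟩
  have hs0 : 0 ≤ s := by rw [hs]; positivity
  -- `h` is an integrable majorant in which `g` and `g² - 1`, both of mean zero, occur linearly.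
  let h : ℝ → ℝ := fun g => ‖x‖ ^ 8 + 8 * ‖x‖ ^ 6 * (g ^ 1 * inner ℝ x z)
    + 8 * ‖x‖ ^ 6 * ((g ^ 2 - 1) * inner ℝ x c)
    + 1000 * (‖x‖ ^ 6 * s) * (g ^ 4 + 1) + 64000 * s ^ 4 * (g ^ 16 + 1)
  have hle : ∀ g, ‖x + g • z + (g ^ 2 - 1) • c‖ ^ 8 ≤ h g := by
    intro g
    have h1 := norm_add_pow_eight_le x (g • z + (g ^ 2 - 1) • c)
    rw [← add_assoc, inner_add_right, inner_smul_right, inner_smul_right] at h1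
    have h2 : ‖g • z + (g ^ 2 - 1) • c‖ ^ 2 ≤ 2 * (g ^ 4 + 1) * s := by
      have h3 : ‖g • z + (g ^ 2 - 1) • c‖ ^ 2 ≤ (‖g • z‖ + ‖(g ^ 2 - 1) • c‖) ^ 2 := by
        gcongr
        exact norm_add_le _ _
      have h4 : ‖g • z‖ ^ 2 = g ^ 2 * ‖z‖ ^ 2 := by rw [norm_smul, mul_pow]; simp
      have h5 : ‖(g ^ 2 - 1) • c‖ ^ 2 = (g ^ 2 - 1) ^ 2 * ‖c‖ ^ 2 := by
        rw [norm_smul, mul_pow]; simp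
      have h6 : g ^ 2 * ‖z‖ ^ 2 ≤ (g ^ 4 + 1) * ‖z‖ ^ 2 := by
        gcongr
        nlinarith [sq_nonneg (g ^ 2 - 1)]
      have h7 : (g ^ 2 - 1) ^ 2 * ‖c‖ ^ 2 ≤ (g ^ 4 + 1) * ‖c‖ ^ 2 := by
        gcongr
        nlinarith [sq_nonneg g]
      rw [hs]
      nlinarith [sq_nonneg (‖g • z‖ - ‖(g ^ 2 - 1) • c‖)]
    have h8 : (‖g • z + (g ^ 2 - 1) • c‖ ^ 2) ^ 4 ≤ 128 * (g ^ 16 + 1) * s ^ 4 := by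
      calc _ ≤ (2 * (g ^ 4 + 1) * s) ^ 4 := by gcongr
        _ = 16 * ((g ^ 4 + 1) ^ 4 * s ^ 4) := by ring
        _ ≤ 16 * ((8 * (g ^ 16 + 1)) * s ^ 4) := by
          gcongr
          have e1 : (g ^ 4 + 1) ^ 2 ≤ 2 * (g ^ 8 + 1) := by nlinarith [sq_nonneg (g ^ 4 - 1)]
          calc (g ^ 4 + 1) ^ 4 = ((g ^ 4 + 1) ^ 2) ^ 2 := by ring
            _ ≤ (2 * (g ^ 8 + 1)) ^ 2 := by gcongr
            _ ≤ _ := by nlinarith [sq_nonneg (g ^ 8 - 1)]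
        _ = _ := by ring
    have h9 : ‖x‖ ^ 6 * ‖g • z + (g ^ 2 - 1) • c‖ ^ 2 ≤ ‖x‖ ^ 6 * (2 * (g ^ 4 + 1) * s) := by
      gcongr
    simp only [h]
    nlinarith
  have i1 := integrable_pow_gaussianReal 1
  have i2 := integrable_pow_gaussianReal 2
  have i4 := integrable_pow_gaussianReal 4
  have i16 := integrable_pow_gaussianReal 16
  have j0 : Integrable (fun _ : ℝ => ‖x‖ ^ 8) γ := integrable_const _
  have j1 : Integrable (fun g : ℝ => 8 * ‖x‖ ^ 6 * (g ^ 1 * inner ℝ x z)) γ :=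
    (i1.mul_const _).const_mul _
  have j2 : Integrable (fun g : ℝ => 8 * ‖x‖ ^ 6 * ((g ^ 2 - 1) * inner ℝ x c)) γ :=
    ((i2.sub (integrable_const _)).mul_const _).const_mul _
  have j3 : Integrable (fun g : ℝ => 1000 * (‖x‖ ^ 6 * s) * (g ^ 4 + 1)) γ :=
    (i4.add (integrable_const _)).const_mul _
  have j4 : Integrable (fun g : ℝ => 64000 * s ^ 4 * (g ^ 16 + 1)) γ :=
    (i16.add (integrable_const _)).const_mul _
  have j01 : Integrable (fun g : ℝ => ‖x‖ ^ 8 + 8 * ‖x‖ ^ 6 * (g ^ 1 * inner ℝ x z)) γ := j0.add j1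
  have j02 : Integrable (fun g : ℝ => ‖x‖ ^ 8 + 8 * ‖x‖ ^ 6 * (g ^ 1 * inner ℝ x z)
    + 8 * ‖x‖ ^ 6 * ((g ^ 2 - 1) * inner ℝ x c)) γ := j01.add j2
  have j03 : Integrable (fun g : ℝ => ‖x‖ ^ 8 + 8 * ‖x‖ ^ 6 * (g ^ 1 * inner ℝ x z)
    + 8 * ‖x‖ ^ 6 * ((g ^ 2 - 1) * inner ℝ x c) + 1000 * (‖x‖ ^ 6 * s) * (g ^ 4 + 1)) γ :=
    j02.add j3
  have hint : Integrable h γ := j03.add j4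
  have hval : ∫ g, h g ∂γ = ‖x‖ ^ 8 + 1000 * (‖x‖ ^ 6 * s) * (m4 + 1)
      + 64000 * s ^ 4 * (m16 + 1) := by
    simp only [h]
    rw [integral_add j03 j4, integral_add j02 j3, integral_add j01 j2, integral_add j0 j1]
    have k1 : ∫ g : ℝ, 8 * ‖x‖ ^ 6 * (g ^ 1 * inner ℝ x z) ∂γ = 0 := by
      rw [integral_const_mul, integral_mul_const]
      simp [γ, integral_id_gaussianReal]
    have k2 : ∫ g : ℝ, 8 * ‖x‖ ^ 6 * ((g ^ 2 - 1) * inner ℝ x c) ∂γ = 0 := by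
      rw [integral_const_mul, integral_mul_const, integral_sub i2 (integrable_const _),
        integral_sq_gaussianReal]
      simp
    have k3 : ∫ g : ℝ, 1000 * (‖x‖ ^ 6 * s) * (g ^ 4 + 1) ∂γ =
        1000 * (‖x‖ ^ 6 * s) * (m4 + 1) := by
      rw [integral_const_mul, integral_add i4 (integrable_const _)]
      have h1 : ∫ _ : ℝ, (1 : ℝ) ∂γ = 1 := by simp [γ]
      rw [h1]
    have k4 : ∫ g : ℝ, 64000 * s ^ 4 * (g ^ 16 + 1) ∂γ = 64000 * s ^ 4 * (m16 + 1) := by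
      rw [integral_const_mul, integral_add i16 (integrable_const _)]
      have h1 : ∫ _ : ℝ, (1 : ℝ) ∂γ = 1 := by simp [γ]
      rw [h1]
    rw [k1, k2, k3, k4]
    simp
  have hfin : ∫ g, h g ∂γ ≤ (‖x‖ ^ 2 + D * s) ^ 4 := by
    rw [hval]
    have a1 : 1000 * (‖x‖ ^ 6 * s) * (m4 + 1) ≤ D * (‖x‖ ^ 6 * s) := by
      have : 0 ≤ ‖x‖ ^ 6 * s := by positivity
      rw [hD]
      nlinarith
    have a2 : 64000 * s ^ 4 * (m16 + 1) ≤ D ^ 4 * s ^ 4 := by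
      have : 64000 * (m16 + 1) ≤ D ^ 4 := by
        have b1 : D ≤ D ^ 4 := le_self_pow₀ hD1 (by norm_num)
        linarith
      nlinarith [pow_nonneg hs0 4]
    have hD0 : 0 ≤ D := by linarith
    have a3 : 0 ≤ 3 * (D * (‖x‖ ^ 6 * s)) + 6 * ‖x‖ ^ 4 * (D * s) ^ 2
      + 4 * ‖x‖ ^ 2 * (D * s) ^ 3 := by positivity
    have a4 : (‖x‖ ^ 2 + D * s) ^ 4 = ‖x‖ ^ 8 + D * (‖x‖ ^ 6 * s) + D ^ 4 * s ^ 4 +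
      (3 * (D * (‖x‖ ^ 6 * s)) + 6 * ‖x‖ ^ 4 * (D * s) ^ 2
      + 4 * ‖x‖ ^ 2 * (D * s) ^ 3) := by ring
    linarith
  calc _ ≤ ∫⁻ g, ENNReal.ofReal (h g) ∂γ := by
        refine lintegral_mono fun g => ?_
        rw [enorm_sq, ← ENNReal.ofReal_pow (by positivity)]
        refine ENNReal.ofReal_le_ofReal ?_
        rw [← pow_mul]
        exact hle g
    _ = ENNReal.ofReal (∫ g, h g ∂γ) :=
        (ofReal_integral_eq_lintegral_ofReal hint
          (ae_of_all _ fun g => (by positivity : (0 : ℝ) ≤ _).trans (hle g))).symm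
    _ ≤ ENNReal.ofReal ((‖x‖ ^ 2 + D * s) ^ 4) := ENNReal.ofReal_le_ofReal hfin
    _ = _ := by
        have hC : (D.toNNReal : ℝ≥0∞) = ENNReal.ofReal D := rfl
        rw [enorm_sq, enorm_sq, enorm_sq, hC, ← ENNReal.ofReal_add (by positivity) (by positivity), ← hs,
          ← ENNReal.ofReal_mul (by linarith), ← ENNReal.ofReal_add (by positivity)
          (mul_nonneg (by linarith) hs0), ENNReal.ofReal_pow
          (add_nonneg (by positivity) (mul_nonneg (by linarith) hs0))]

end Smoothness

/-! ### The norm of `L⁴` for functions with values in `[0, ∞]` -/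

section LFourNorm

variable {α : Type*} {mα : MeasurableSpace α}

/-- The norm of `L⁴(μ)` for functions with values in `[0, ∞]`. -/
def lfour (μ : Measure α) (f : α → ℝ≥0∞) : ℝ≥0∞ := (∫⁻ x, f x ^ 4 ∂μ) ^ (1 / 4 : ℝ)

theorem rpow_quarter_le {a b : ℝ≥0∞} : a ^ (1 / 4 : ℝ) ≤ b ↔ a ≤ b ^ 4 := by
  have h := ENNReal.rpow_le_rpow_iff (x := a) (y := b ^ 4) (z := 1 / 4) (by norm_num)
  rw [← ENNReal.rpow_natCast, ← ENNReal.rpow_mul] at h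
  simpa using h

theorem lfour_le_iff {μ : Measure α} {f : α → ℝ≥0∞} {b : ℝ≥0∞} :
    lfour μ f ≤ b ↔ ∫⁻ x, f x ^ 4 ∂μ ≤ b ^ 4 := rpow_quarter_le

theorem lfour_pow (μ : Measure α) (f : α → ℝ≥0∞) : lfour μ f ^ 4 = ∫⁻ x, f x ^ 4 ∂μ := by
  rw [lfour, ← ENNReal.rpow_natCast, ← ENNReal.rpow_mul]
  simp

theorem lfour_mono {μ : Measure α} {f g : α → ℝ≥0∞} (h : ∀ x, f x ≤ g x) :
    lfour μ f ≤ lfour μ g := by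
  rw [lfour_le_iff, lfour_pow]
  exact lintegral_mono fun x => pow_le_pow_left₀ zero_le (h x) 4

theorem lfour_add_le {μ : Measure α} {f g : α → ℝ≥0∞} (hf : AEMeasurable f μ)
    (hg : AEMeasurable g μ) : lfour μ (fun x => f x + g x) ≤ lfour μ f + lfour μ g := by
  have h := ENNReal.lintegral_Lp_add_le hf hg (p := 4) (by norm_num)
  have e : ∀ x : ℝ≥0∞, x ^ (4 : ℝ) = x ^ 4 := fun x => by
    rw [← ENNReal.rpow_natCast]; norm_num
  simp only [e, Pi.add_apply] at h
  exact h

theorem lfour_const (μ : Measure α) [IsProbabilityMeasure μ] (b : ℝ≥0∞) :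
    lfour μ (fun _ => b) = b := by
  rw [lfour, lintegral_const, measure_univ, mul_one, ← ENNReal.rpow_natCast, ← ENNReal.rpow_mul]
  simp

theorem lfour_const_mul {μ : Measure α} {f : α → ℝ≥0∞} (hf : AEMeasurable f μ) (b : ℝ≥0∞) :
    lfour μ (fun x => b * f x) = b * lfour μ f := by
  simp only [lfour, mul_pow]
  rw [lintegral_const_mul'' _ (hf.pow_const 4), ENNReal.mul_rpow_of_nonneg _ _ (by norm_num)]
  congr 1
  rw [← ENNReal.rpow_natCast, ← ENNReal.rpow_mul]
  simp

end LFourNorm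

/-! ### Hilbert space valued Gaussian chaoses of order two -/

section Chaos

variable {H : Type*} [NormedAddCommGroup H] [InnerProductSpace ℝ H]

/-- The standard Gaussian measure on `ℝⁿ`. -/
def gaussianPi (n : ℕ) : Measure (Fin n → ℝ) := Measure.pi fun _ => gaussianReal 0 1

instance (n : ℕ) : IsProbabilityMeasure (gaussianPi n) := by
  unfold gaussianPi
  infer_instance

/-- Tonelli for the last coordinate of the standard Gaussian measure. -/
theorem lintegral_gaussianPi_succ (n : ℕ) {f : (Fin (n + 1) → ℝ) → ℝ≥0∞} (hf : Measurable f) :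
    ∫⁻ g, f g ∂(gaussianPi (n + 1)) =
      ∫⁻ g, ∫⁻ a, f (Fin.snoc (α := fun _ => ℝ) g a) ∂(gaussianReal 0 1) ∂(gaussianPi n) := by
  have h := (measurePreserving_piFinSuccAbove
    (fun _ : Fin (n + 1) => gaussianReal 0 1) (Fin.last n)).symm
  have h2 := h.lintegral_comp hf
  rw [gaussianPi, ← h2, lintegral_prod_symm _ (by fun_prop)]
  simp [gaussianPi, MeasurableEquiv.piFinSuccAbove_symm_apply, Fin.insertNthEquiv,
    Fin.insertNth_last']

/-- The sum `∑ₖ gₖ oₖ + 1/2 ∑_{k,l} (gₖ gₗ - δₖₗ) cₖₗ` of chaoses of the orders one and two. -/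
def chaos (n : ℕ) (o : ℕ → H) (c : ℕ → ℕ → H) (g : Fin n → ℝ) : H :=
  ∑ k : Fin n, g k • o k + (1 / 2 : ℝ) • ∑ k : Fin n, ∑ l : Fin n,
    (g k * g l - if k = l then 1 else 0) • c k l

/-- As a function of its last variable `a`, a chaos of order two has the form
`x + a z + (a² - 1) c`, where `x` is a chaos of order two and `z` an affine function of the other
variables. -/
theorem chaos_snoc (n : ℕ) (o : ℕ → H) (c : ℕ → ℕ → H) (g : Fin n → ℝ) (a : ℝ) :
    chaos (n + 1) o c (Fin.snoc (α := fun _ => ℝ) g a) = chaos n o c g +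
      a • (o n + ∑ l : Fin n, g l • ((1 / 2 : ℝ) • (c n l + c l n))) +
      (a ^ 2 - 1) • ((1 / 2 : ℝ) • c n n) := by
  have h1 : ∀ k : Fin n, ¬ Fin.last n = k.castSucc := fun k => (Fin.castSucc_ne_last k).symm
  have h2 : ∀ k : Fin n, ¬ k.castSucc = Fin.last n := fun k => Fin.castSucc_ne_last k
  simp only [chaos, Fin.sum_univ_castSucc, Fin.snoc_castSucc, Fin.snoc_last, Fin.val_castSucc,
    Fin.val_last, Fin.castSucc_inj, h1, h2, if_true, if_false, sub_zero, Finset.sum_add_distrib,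
    smul_add, Finset.smul_sum, smul_smul]
  have e1 : ∀ l : Fin n, (1 / 2 * (a * g l)) • c n l = (a * (g l * (1 / 2))) • c n l :=
    fun l => by congr 1; ring
  have e2 : ∀ l : Fin n, (1 / 2 * (g l * a)) • c l n = (a * (g l * (1 / 2))) • c l n :=
    fun l => by congr 1; ring
  have e3 : (1 / 2 * (a * a - 1)) • c n n = ((a ^ 2 - 1) * (1 / 2)) • c n n := by
    congr 1; ring
  simp only [e1, e2, e3]
  abel

theorem continuous_chaos (n : ℕ) (o : ℕ → H) (c : ℕ → ℕ → H) : Continuous (chaos n o c) := by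
  unfold chaos
  fun_prop

theorem enorm_half_smul_sq (c : H) : ‖(1 / 2 : ℝ) • c‖ₑ ^ 2 ≤ ‖c‖ₑ ^ 2 := by
  gcongr
  rw [← ofReal_norm, ← ofReal_norm, norm_smul]
  refine ENNReal.ofReal_le_ofReal ?_
  norm_num
  linarith [norm_nonneg c]

theorem enorm_half_smul_add_sq (c d : H) :
    ‖(1 / 2 : ℝ) • (c + d)‖ₑ ^ 2 ≤ ‖c‖ₑ ^ 2 + ‖d‖ₑ ^ 2 := by
  rw [← ofReal_norm, ← ofReal_norm, ← ofReal_norm, ← ENNReal.ofReal_pow (norm_nonneg _),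
    ← ENNReal.ofReal_pow (norm_nonneg _), ← ENNReal.ofReal_pow (norm_nonneg _),
    ← ENNReal.ofReal_add (by positivity) (by positivity), norm_smul]
  refine ENNReal.ofReal_le_ofReal ?_
  have h := norm_add_le c d
  have h0 := norm_nonneg (c + d)
  norm_num
  nlinarith [sq_nonneg (‖c‖ - ‖d‖)]

/-- One further independent Gaussian coordinate: the defining inequality of a smoothness constant is
integrated over the other coordinates, with the triangle inequality of `L⁴`. -/
theorem lfour_snoc_le {C : ℝ≥0} (hC : IsSmoothnessConst H C)
    (n : ℕ) {f : (Fin (n + 1) → ℝ) → H} {x z : (Fin n → ℝ) → H} {c : H}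
    (hf : Continuous f) (hx : Continuous x) (hz : Continuous z)
    (h : ∀ g a, f (Fin.snoc (α := fun _ => ℝ) g a) = x g + a • z g + (a ^ 2 - 1) • c) :
    lfour (gaussianPi (n + 1)) (fun g => ‖f g‖ₑ ^ 2) ≤
      lfour (gaussianPi n) (fun g => ‖x g‖ₑ ^ 2) +
        C * (lfour (gaussianPi n) (fun g => ‖z g‖ₑ ^ 2) + ‖c‖ₑ ^ 2) := by
  have mx : Measurable fun g => ‖x g‖ₑ ^ 2 := (hx.enorm.measurable).pow_const 2
  have mz : Measurable fun g => ‖z g‖ₑ ^ 2 := (hz.enorm.measurable).pow_const 2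
  have mf : Measurable fun g => (‖f g‖ₑ ^ 2) ^ 4 := ((hf.enorm.measurable).pow_const 2).pow_const 4
  calc _ ≤ lfour (gaussianPi n) (fun g => ‖x g‖ₑ ^ 2 + C * (‖z g‖ₑ ^ 2 + ‖c‖ₑ ^ 2)) := by
        rw [lfour_le_iff, lfour_pow, lintegral_gaussianPi_succ n mf]
        refine lintegral_mono fun g => ?_
        simp only [h]
        exact hC.bound _ _ _
    _ ≤ _ := by
        refine (lfour_add_le mx.aemeasurable (by fun_prop)).trans ?_
        gcongr
        rw [lfour_const_mul (by fun_prop)]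
        gcongr
        refine (lfour_add_le mz.aemeasurable (by fun_prop)).trans ?_
        rw [lfour_const]

theorem lfour_linear_chaos_le {C : ℝ≥0} (hC : IsSmoothnessConst H C)
    (y : H) (o : ℕ → H) (n : ℕ) :
    lfour (gaussianPi n) (fun g => ‖y + ∑ k : Fin n, g k • o k‖ₑ ^ 2) ≤
      ‖y‖ₑ ^ 2 + C * ∑ k ∈ Finset.range n, ‖o k‖ₑ ^ 2 := by
  induction n with
  | zero => simp [lfour_const]
  | succ n ih =>
    refine (lfour_snoc_le hC n (x := fun g => y + ∑ k : Fin n, g k • o k) (z := fun _ => o n)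
      (c := 0) (by fun_prop) (by fun_prop) (by fun_prop) fun g a => ?_).trans ?_
    · simp [Fin.sum_univ_castSucc, add_assoc]
    · rw [lfour_const, Finset.sum_range_succ, enorm_zero, zero_pow two_ne_zero, add_zero, mul_add,
        ← add_assoc]
      exact add_le_add ih le_rfl

/-- The eighth moment of a chaos of order two is controlled by its Hilbert-Schmidt size, with a
constant that depends neither on the number of variables nor on the offset `y`. The factor `C ^ 2`
arises because the affine function `z` of `chaos_snoc` is estimated by `lfour_linear_chaos_le`. -/
theorem lfour_chaos_le {C : ℝ≥0} (hC : IsSmoothnessConst H C)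
    (y : H) (o : ℕ → H) (c : ℕ → ℕ → H) (n : ℕ) :
    lfour (gaussianPi n) (fun g => ‖y + chaos n o c g‖ₑ ^ 2) ≤
      ‖y‖ₑ ^ 2 + (C ^ 2 : ℝ≥0) * (∑ k ∈ Finset.range n, ‖o k‖ₑ ^ 2 +
        ∑ k ∈ Finset.range n, ∑ l ∈ Finset.range n, ‖c k l‖ₑ ^ 2) := by
  induction n with
  | zero => simp [lfour_const, chaos]
  | succ n ih =>
    refine (lfour_snoc_le hC n (x := fun g => y + chaos n o c g)
      (z := fun g => o n + ∑ l : Fin n, g l • ((1 / 2 : ℝ) • (c n l + c l n)))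
      (c := (1 / 2 : ℝ) • c n n) ?_ ?_ (by fun_prop) fun g a => ?_).trans ?_
    · exact continuous_const.add (continuous_chaos _ _ _)
    · exact continuous_const.add (continuous_chaos _ _ _)
    · simp [chaos_snoc, add_assoc]
    · have h1 := lfour_linear_chaos_le hC (o n) (fun l => (1 / 2 : ℝ) • (c n l + c l n)) n
      have hC' : (C : ℝ≥0∞) ≤ (C ^ 2 : ℝ≥0) := by
        exact_mod_cast le_self_pow₀ hC.one_le (by norm_num)
      have h2 : ∑ l ∈ Finset.range n, ‖(1 / 2 : ℝ) • (c n l + c l n)‖ₑ ^ 2 ≤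
          ∑ l ∈ Finset.range n, ‖c n l‖ₑ ^ 2 + ∑ l ∈ Finset.range n, ‖c l n‖ₑ ^ 2 := by
        rw [← Finset.sum_add_distrib]
        exact Finset.sum_le_sum fun l _ => enorm_half_smul_add_sq _ _
      have h3 := enorm_half_smul_sq (c n n)
      simp only [Finset.sum_range_succ, Finset.sum_add_distrib]
      generalize ∑ k ∈ Finset.range n, ‖o k‖ₑ ^ 2 = a1 at *
      generalize ∑ l ∈ Finset.range n, ‖c n l‖ₑ ^ 2 = a2 at *
      generalize ∑ l ∈ Finset.range n, ‖c l n‖ₑ ^ 2 = a3 at *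
      generalize ∑ k ∈ Finset.range n, ∑ l ∈ Finset.range n, ‖c k l‖ₑ ^ 2 = a4 at *
      calc _ ≤ (‖y‖ₑ ^ 2 + (C ^ 2 : ℝ≥0) * (a1 + a4)) +
            C * ((‖o n‖ₑ ^ 2 + C * (a2 + a3)) + ‖c n n‖ₑ ^ 2) := by
            gcongr
            exact h1.trans (by gcongr)
        _ = (‖y‖ₑ ^ 2 + (C ^ 2 : ℝ≥0) * (a1 + a4)) +
            (C * ‖o n‖ₑ ^ 2 + (C ^ 2 : ℝ≥0) * (a2 + a3) + C * ‖c n n‖ₑ ^ 2) := by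
            push_cast
            ring
        _ ≤ (‖y‖ₑ ^ 2 + (C ^ 2 : ℝ≥0) * (a1 + a4)) +
            ((C ^ 2 : ℝ≥0) * ‖o n‖ₑ ^ 2 + (C ^ 2 : ℝ≥0) * (a2 + a3)
              + (C ^ 2 : ℝ≥0) * ‖c n n‖ₑ ^ 2) := by
            gcongr
        _ = _ := by ring

end Chaos

/-! ### Law and independence of the increments of the Wiener process -/

section Increments

variable {Ω : Type*} {mΩ : MeasurableSpace Ω} {P : Measure Ω}
variable {U : Type*} [NormedAddCommGroup U] [InnerProductSpace ℝ U]

/-- The first `n` coordinates `ηₖ^{-1/2} (W(t) - W(s), eₖ)` of an increment of `W`. Those with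
`ηₖ = 0` vanish, as `0⁻¹ = 0`. -/
def incrementCoord (q : Covariance U) (W : ℝ≥0 → Ω → U) (s t : ℝ≥0) (n : ℕ) (ω : Ω) : Fin n → ℝ :=
  fun k => (Real.sqrt (q.ev k))⁻¹ * inner ℝ (W t ω - W s ω) (q.ef k)

/-- The standard deviation of the `k`-th coordinate over a time step of length `h`; it is zero where
`ηₖ = 0`. -/
def coordDev (q : Covariance U) (h : ℝ) (k : ℕ) : ℝ := if q.ev k = 0 then 0 else Real.sqrt h

variable {q : Covariance U} {W : ℝ≥0 → Ω → U} {𝓕 : Filtration ℝ≥0 mΩ} {T s t : ℝ≥0}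

theorem inner_Q_sum_ef (q : Covariance U) (n : ℕ) (c : Fin n → ℝ) :
    inner ℝ (q.Q (∑ k : Fin n, c k • q.ef k)) (∑ k : Fin n, c k • q.ef k) = ∑ k : Fin n, q.ev k * c k ^ 2 := by
  have hinj : Function.Injective fun k : Fin n => (k : ℕ) := Fin.val_injective
  have ho : Orthonormal ℝ fun k : Fin n => q.ef k := q.ef.orthonormal.comp _ hinj
  have e : q.Q (∑ k : Fin n, c k • q.ef k) = ∑ k : Fin n, (c k * q.ev k) • q.ef k := by
    rw [map_sum]
    refine Finset.sum_congr rfl fun k _ => ?_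
    rw [map_smul, q.ef_eigen, smul_smul]
  rw [e, ho.inner_sum]
  refine Finset.sum_congr rfl fun k _ => ?_
  simp
  ring

theorem inner_incrementCoord (n : ℕ) (c : Fin n → ℝ) (ω : Ω) :
    ∑ k, c k * incrementCoord q W s t n ω k =
      inner ℝ (∑ k : Fin n, (c k * (Real.sqrt (q.ev k))⁻¹) • q.ef k) (W t ω - W s ω) := by
  rw [sum_inner]
  refine Finset.sum_congr rfl fun k _ => ?_
  rw [real_inner_smul_left, real_inner_comm, incrementCoord]
  ring

variable [MeasurableSpace U]

theorem stronglyMeasurable_increment (hW : IsWiener q 𝓕 P T W) (hst : s ≤ t) (ht : t ≤ T) :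
    StronglyMeasurable[𝓕 t] fun ω => W t ω - W s ω :=
  (hW.adapted t ht).sub ((hW.adapted s (hst.trans ht)).mono (𝓕.mono hst))

theorem measurable_incrementCoord (hW : IsWiener q 𝓕 P T W) (hst : s ≤ t) (ht : t ≤ T) (n : ℕ) :
    Measurable[𝓕 t] (incrementCoord q W s t n) := by
  refine @measurable_pi_lambda Ω (Fin n) _ (𝓕 t) _ _ fun k => ?_
  have h := (stronglyMeasurable_increment hW hst ht).inner
    (stronglyMeasurable_const (b := q.ef k)) (𝕜 := ℝ)
  exact (h.measurable).const_mul _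

/-- The coordinates of an increment are independent centred Gaussian variables: the characteristic
function of their joint law is that of the product law, as all scalar products of the increment are
Gaussian with the covariance `Q`. -/
theorem map_incrementCoord [IsProbabilityMeasure P]
    (hW : IsWiener q 𝓕 P T W) (hst : s ≤ t) (ht : t ≤ T) (n : ℕ) :
    P.map (incrementCoord q W s t n) =
      (gaussianPi n).map fun g (k : Fin n) => coordDev q ((t : ℝ) - s) k * g k := by
  have hm := (measurable_incrementCoord hW hst ht n).mono (𝓕.le t) le_rfl
  have hst' : (0 : ℝ) ≤ (t : ℝ) - s := sub_nonneg.2 (by exact_mod_cast hst)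
  have : IsProbabilityMeasure (P.map (incrementCoord q W s t n)) :=
    Measure.isProbabilityMeasure_map hm.aemeasurable
  have h1 : (gaussianPi n).map (fun g (k : Fin n) => coordDev q ((t : ℝ) - s) k * g k) =
      Measure.pi fun k : Fin n =>
        (gaussianReal 0 1).map fun x => coordDev q ((t : ℝ) - s) k * x := by
    rw [gaussianPi, Measure.pi_map_pi]
    exact fun k => by fun_prop
  rw [h1]
  simp only [gaussianReal_map_const_mul, mul_zero, mul_one]
  rw [← charFun_eq_pi_iff]
  intro c
  set u : U := ∑ k : Fin n, (c k * (Real.sqrt (q.ev k))⁻¹) • q.ef k with hu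
  have hmu : Measurable fun ω => inner ℝ u (W t ω - W s ω) :=
    ((stronglyMeasurable_const (b := u)).inner
      ((stronglyMeasurable_increment hW hst ht).mono (𝓕.le t)) (𝕜 := ℝ)).measurable
  have h2 : charFun ((P.map (incrementCoord q W s t n)).map (WithLp.toLp 2)) c =
      charFun (P.map fun ω => inner ℝ u (W t ω - W s ω)) 1 := by
    rw [charFun_apply, charFun_apply, integral_map (by fun_prop) (by fun_prop),
      integral_map hm.aemeasurable (by fun_prop), integral_map hmu.aemeasurable (by fun_prop)]
    refine integral_congr_ae (ae_of_all _ fun ω => ?_)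
    simp only [PiLp.inner_apply]
    rw [← inner_incrementCoord]
    simp
  rw [h2, hW.gaussian s t hst ht u, charFun_gaussianReal]
  simp only [charFun_gaussianReal]
  rw [← Complex.exp_sum]
  congr 1
  rw [hu, inner_Q_sum_ef]
  have h3 : 0 ≤ ∑ k : Fin n, q.ev k * (c k * (Real.sqrt (q.ev k))⁻¹) ^ 2 :=
    Finset.sum_nonneg fun k _ => mul_nonneg (q.ev_nonneg k) (sq_nonneg _)
  have h4 : ((((t : ℝ) - s) * ∑ k : Fin n, q.ev k * (c k * (Real.sqrt (q.ev k))⁻¹) ^ 2).toNNReal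
      : ℝ) = ∑ k : Fin n, coordDev q ((t : ℝ) - s) k ^ 2 * c k ^ 2 := by
    rw [Real.coe_toNNReal _ (mul_nonneg hst' h3), Finset.mul_sum]
    refine Finset.sum_congr rfl fun k _ => ?_
    by_cases hk : q.ev k = 0
    · simp [coordDev, hk]
    · rw [coordDev, if_neg hk, Real.sq_sqrt hst', mul_pow, inv_pow, Real.sq_sqrt (q.ev_nonneg k)]
      field_simp
  have h5 : ((((t : ℝ) - s) * ∑ k : Fin n, q.ev k * (c k * (Real.sqrt (q.ev k))⁻¹) ^ 2).toNNReal
      : ℂ) = ∑ k : Fin n, (coordDev q ((t : ℝ) - s) k : ℂ) ^ 2 * (c k : ℂ) ^ 2 := by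
    exact_mod_cast congrArg (fun x : ℝ => (x : ℂ)) h4
  simp only [Complex.ofReal_zero, mul_zero, zero_mul, zero_sub, Complex.ofReal_one, one_pow,
    mul_one]
  rw [h5, Finset.sum_div, ← Finset.sum_neg_distrib]
  refine Finset.sum_congr rfl fun k _ => ?_
  simp

/-- Freezing: an independent variable may be integrated out first. -/
theorem lintegral_comp_indepFun {E F : Type*} [MeasurableSpace E] [MeasurableSpace F]
    [IsFiniteMeasure P] {S : Ω → E} {b : Ω → F} (hS : Measurable S) (hb : Measurable b)
    (h : IndepFun S b P) {f : E × F → ℝ≥0∞} (hf : Measurable f) :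
    ∫⁻ ω, f (S ω, b ω) ∂P = ∫⁻ ω, ∫⁻ y, f (S ω, y) ∂(P.map b) ∂P := by
  have h1 := (indepFun_iff_map_prod_eq_prod_map_map hS.aemeasurable hb.aemeasurable).1 h
  rw [← lintegral_map hf (hS.prodMk hb), h1, lintegral_prod _ hf.aemeasurable,
    lintegral_map hf.lintegral_prod_right' hS]

theorem indepFun_incrementCoord [BorelSpace U] {E : Type*} [MeasurableSpace E]
    (hW : IsWiener q 𝓕 P T W) (hst : s ≤ t) (ht : t ≤ T) (n : ℕ) {S : Ω → E}
    (hS : Measurable[𝓕 s] S) : IndepFun S (incrementCoord q W s t n) P := by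
  have h := hW.indep s t hst ht
  rw [IndepFun_iff_Indep]
  refine (indep_of_indep_of_le_left (indep_of_indep_of_le_right h hS.comap_le) ?_).symm
  have e : incrementCoord q W s t n =
      (fun v (k : Fin n) => (Real.sqrt (q.ev k))⁻¹ * inner ℝ v (q.ef k)) ∘ fun ω => W t ω - W s ω := rfl
  rw [e, ← MeasurableSpace.comap_comp]
  refine MeasurableSpace.comap_mono (Measurable.comap_le ?_)
  exact measurable_pi_lambda _ fun k =>
    (by fun_prop : Continuous fun v : U => (Real.sqrt (q.ev k))⁻¹ * inner ℝ v (q.ef k)).measurable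

end Increments

/-! ### One step of a scheme driven by Brownian increments -/

section OneStep

variable {Ω : Type*} {mΩ : MeasurableSpace Ω} {P : Measure Ω}
variable {U : Type*} [NormedAddCommGroup U] [InnerProductSpace ℝ U]
variable {H : Type*} [NormedAddCommGroup H] [InnerProductSpace ℝ H]
variable {q : Covariance U} {W : ℝ≥0 → Ω → U} {𝓕 : Filtration ℝ≥0 mΩ} {T s t : ℝ≥0}

/-- The sum `∑ₖ bₖ oₖ + 1/2 ∑_{k,l} (bₖ bₗ - δₖₗ h) cₖₗ` for the increments `b` of Brownian motions
over a time step of length `h`. -/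
def stepNoise (h : ℝ) (n : ℕ) (o : ℕ → H) (c : ℕ → ℕ → H) (b : Fin n → ℝ) : H :=
  ∑ k : Fin n, b k • o k + (1 / 2 : ℝ) • ∑ k : Fin n, ∑ l : Fin n,
    (b k * b l - if k = l then h else 0) • c k l

theorem continuous_stepNoise {E : Type*} [TopologicalSpace E] (h : ℝ) (n : ℕ) {o : ℕ → E → H}
    {c : ℕ → ℕ → E → H} (ho : ∀ k, Continuous (o k)) (hc : ∀ k l, Continuous (c k l)) :
    Continuous fun p : E × (Fin n → ℝ) =>
      stepNoise h n (fun k => o k p.1) (fun k l => c k l p.1) p.2 := by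
  unfold stepNoise
  fun_prop

/-- In terms of standard Gaussian variables, the noise of one step is a chaos of order two. The
coefficients have to vanish where `ηₖ = 0`, because the increment is zero there but the term `δₖₗ h`
is not. -/
theorem stepNoise_coordDev {h : ℝ} (hh : 0 ≤ h) (n : ℕ) {o : ℕ → H} {c : ℕ → ℕ → H}
    (ho : ∀ k, q.ev k = 0 → o k = 0) (hc₁ : ∀ k l, q.ev k = 0 → c k l = 0)
    (hc₂ : ∀ k l, q.ev l = 0 → c k l = 0) (g : Fin n → ℝ) :
    stepNoise h n o c (fun k : Fin n => coordDev q h k * g k) =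
      chaos n (fun k => Real.sqrt h • o k) (fun k l => h • c k l) g := by
  unfold stepNoise chaos
  congr 1
  · refine Finset.sum_congr rfl fun k _ => ?_
    by_cases hk : q.ev k = 0
    · simp [ho k hk]
    · simp only [coordDev, if_neg hk]
      rw [smul_smul, mul_comm]
  · congr 1
    refine Finset.sum_congr rfl fun k _ => Finset.sum_congr rfl fun l _ => ?_
    by_cases hk : q.ev k = 0
    · simp [hc₁ k l hk]
    by_cases hl : q.ev l = 0
    · simp [hc₂ k l hl]
    simp only [coordDev, if_neg hk, if_neg hl, smul_smul]
    congr 1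
    have h2 : Real.sqrt h * g k * (Real.sqrt h * g l) = h * (g k * g l) := by
      calc _ = (Real.sqrt h * Real.sqrt h) * (g k * g l) := by ring
        _ = _ := by rw [Real.mul_self_sqrt hh]
    rw [h2]
    split_ifs <;> ring

variable [MeasurableSpace U] [BorelSpace U] [IsProbabilityMeasure P]

/-- One step from a state `S` that is known at the time `s`: given `S`, the noise is a centred chaos
of order two, so that it contributes to the squared norm in `L⁴` only through its variance. -/
theorem lfour_step_le {C : ℝ≥0} (hC : IsSmoothnessConst H C)
    (hW : IsWiener q 𝓕 P T W) (hst : s ≤ t) (ht : t ≤ T) (n : ℕ)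
    {E : Type*} [TopologicalSpace E] [SecondCountableTopology E] [MeasurableSpace E] [BorelSpace E]
    {S : Ω → E} (hS : Measurable[𝓕 s] S) {x : E → H} {o : ℕ → E → H} {c : ℕ → ℕ → E → H}
    (hx : Continuous x) (ho : ∀ k, Continuous (o k)) (hc : ∀ k l, Continuous (c k l))
    (ho₀ : ∀ k, q.ev k = 0 → ∀ e, o k e = 0) (hc₁ : ∀ k l, q.ev k = 0 → ∀ e, c k l e = 0)
    (hc₂ : ∀ k l, q.ev l = 0 → ∀ e, c k l e = 0) :
    lfour P (fun ω => ‖x (S ω) + stepNoise ((t : ℝ) - s) n (fun k => o k (S ω))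
        (fun k l => c k l (S ω)) (incrementCoord q W s t n ω)‖ₑ ^ 2) ≤
      lfour P (fun ω => ENNReal.ofReal (‖x (S ω)‖ ^ 2 + (C : ℝ) ^ 2 *
        (((t : ℝ) - s) * ∑ k ∈ Finset.range n, ‖o k (S ω)‖ ^ 2 + ((t : ℝ) - s) ^ 2 *
          ∑ k ∈ Finset.range n, ∑ l ∈ Finset.range n, ‖c k l (S ω)‖ ^ 2))) := by
  have hst' : (0 : ℝ) ≤ (t : ℝ) - s := sub_nonneg.2 (by exact_mod_cast hst)
  obtain ⟨h, hh⟩ : ∃ h, h = (t : ℝ) - s := ⟨_, rfl⟩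
  have hm := (measurable_incrementCoord hW hst ht n).mono (𝓕.le t) le_rfl
  have hind := indepFun_incrementCoord hW hst ht n hS
  have hmap := map_incrementCoord hW hst ht n
  rw [← hh] at hmap hst' ⊢
  let f : E × (Fin n → ℝ) → ℝ≥0∞ := fun p =>
    (‖x p.1 + stepNoise h n (fun k => o k p.1) (fun k l => c k l p.1) p.2‖ₑ ^ 2) ^ 4
  have hfc : Continuous fun p : E × (Fin n → ℝ) =>
      x p.1 + stepNoise h n (fun k => o k p.1) (fun k l => c k l p.1) p.2 :=
    (hx.comp continuous_fst).add (continuous_stepNoise h n ho hc)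
  have hf : Measurable f := ((hfc.enorm.measurable).pow_const 2).pow_const 4
  rw [lfour_le_iff, lfour_pow]
  have h1 := lintegral_comp_indepFun (hS.mono (𝓕.le s) le_rfl) hm hind hf
  refine (le_of_eq h1).trans (lintegral_mono fun ω => ?_)
  rw [hmap, lintegral_map (by fun_prop) (by fun_prop)]
  simp only [f]
  simp only [stepNoise_coordDev hst' n (fun k hk => ho₀ k hk (S ω))
    (fun k l hk => hc₁ k l hk (S ω)) (fun k l hk => hc₂ k l hk (S ω))]
  have h2 := lfour_chaos_le hC (x (S ω)) (fun k => Real.sqrt h • o k (S ω))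
    (fun k l => h • c k l (S ω)) n
  rw [lfour_le_iff] at h2
  refine h2.trans (pow_le_pow_left₀ zero_le (le_of_eq ?_) 4)
  have hC2 : ((C ^ 2 : ℝ≥0) : ℝ≥0∞) = ENNReal.ofReal ((C : ℝ) ^ 2) := by
    rw [← NNReal.coe_pow, ENNReal.ofReal_coe_nnreal]
  have e1 : ∑ k ∈ Finset.range n, ‖Real.sqrt h • o k (S ω)‖ₑ ^ 2 =
      ENNReal.ofReal (h * ∑ k ∈ Finset.range n, ‖o k (S ω)‖ ^ 2) := by
    rw [Finset.mul_sum, ENNReal.ofReal_sum_of_nonneg fun k _ => by positivity]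
    refine Finset.sum_congr rfl fun k _ => ?_
    rw [enorm_sq, norm_smul, mul_pow, Real.norm_eq_abs, sq_abs, Real.sq_sqrt hst']
  have e2 : ∑ k ∈ Finset.range n, ∑ l ∈ Finset.range n, ‖h • c k l (S ω)‖ₑ ^ 2 =
      ENNReal.ofReal (h ^ 2 * ∑ k ∈ Finset.range n, ∑ l ∈ Finset.range n,
        ‖c k l (S ω)‖ ^ 2) := by
    rw [Finset.mul_sum, ENNReal.ofReal_sum_of_nonneg fun k _ => by positivity]
    refine Finset.sum_congr rfl fun k _ => ?_
    rw [Finset.mul_sum, ENNReal.ofReal_sum_of_nonneg fun l _ => by positivity]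
    refine Finset.sum_congr rfl fun l _ => ?_
    rw [enorm_sq, norm_smul, mul_pow, Real.norm_eq_abs, sq_abs]
  rw [e1, e2, enorm_sq, hC2, ← ENNReal.ofReal_add (by positivity) (by positivity),
    ← ENNReal.ofReal_mul (by positivity), ← ENNReal.ofReal_add (by positivity) (by positivity)]

end OneStep

/-! ### Hilbert-Schmidt operators on the reproducing kernel Hilbert space -/

section HilbertSchmidt

variable {Ω : Type*} {U : Type*} [NormedAddCommGroup U] [InnerProductSpace ℝ U] [CompleteSpace U]
variable {H : Type*} [NormedAddCommGroup H] [InnerProductSpace ℝ H]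
variable {q : Covariance U} {W : ℝ≥0 → Ω → U} {T : ℝ≥0}

theorem Covariance.basisVec_eq_zero {k : ℕ} (hk : q.ev k = 0) : q.basisVec k = 0 := by
  have h : q.incl (q.basisVec k) = 0 := by rw [q.incl_basisVec, hk]; simp
  exact Subtype.ext h

theorem Covariance.HS.sum_norm_sq_le (O : q.HS H) (n : ℕ) :
    ∑ k ∈ Finset.range n, ‖O (q.basisVec k)‖ ^ 2 ≤ ‖O‖ ^ 2 := by
  rw [HS.norm_sq]
  have h : Memℓp (fun k => O (q.basisVec k)) 2 := O.2
  have hs : Summable fun k => ‖O (q.basisVec k)‖ ^ 2 := by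
    rw [memℓp_gen_iff (by norm_num)] at h
    simpa using h
  exact hs.sum_le_tsum _ fun k _ => sq_nonneg _

/-- The evaluation `O ↦ O (√ηₖ eₖ)` as a bounded operator on the Hilbert-Schmidt operators. -/
def Covariance.HS.eval (q : Covariance U) (H : Type*) [NormedAddCommGroup H]
    [InnerProductSpace ℝ H] (k : ℕ) : q.HS H →L[ℝ] H :=
  LinearMap.mkContinuous
    { toFun := fun O => O (q.basisVec k)
      map_add' := fun O O' => by rw [map_add]; rfl
      map_smul' := fun a O => by rw [map_smul]; rfl } 1 fun O => by
    rw [one_mul]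
    refine le_of_sq_le_sq ?_ (norm_nonneg O)
    refine le_trans ?_ (HS.sum_norm_sq_le O (k + 1))
    exact Finset.single_le_sum (f := fun k => ‖O (q.basisVec k)‖ ^ 2) (fun i _ => sq_nonneg _)
      (Finset.self_mem_range_succ k)

theorem continuous_apply_basisVec {G : H → q.HS H} (hG : Continuous G) (k : ℕ) :
    Continuous fun y => G y (q.basisVec k) :=
  (Covariance.HS.eval q H k).continuous.comp hG

theorem apply_noiseIncrement (O : q.HS H) (M K m : ℕ) (ω : Ω) :
    O (noiseIncrement q W T M K m ω) = ∑ k : Fin K,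
      incrementCoord q W (grid T M m) (grid T M (m + 1)) K ω k • O (q.basisVec k) := by
  rw [noiseIncrement, map_sum, Finset.sum_range]
  simp only [map_smul]
  rfl

/-- `F` and `G` are Lipschitz continuous and of linear growth, and `G'` is bounded, with the one
constant `L`. -/
structure CoefficientBounds (q : Covariance U) (F : H → H) (G : H → q.HS H) (L : ℝ) : Prop where
  nonneg : 0 ≤ L
  F_lip : ∀ u v, ‖F u - F v‖ ≤ L * ‖u - v‖
  G_lip : ∀ u v, ‖G u - G v‖ ≤ L * ‖u - v‖
  norm_fderiv_G_le : ∀ v, ‖fderiv ℝ G v‖ ≤ L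
  norm_F_le : ∀ v, ‖F v‖ ≤ L * (1 + ‖v‖)
  norm_G_le : ∀ v, ‖G v‖ ≤ L * (1 + ‖v‖)

theorem CoefficientBounds.norm_G_sq_le {F : H → H} {G : H → q.HS H} {L : ℝ}
    (h : CoefficientBounds q F G L) (y : H) :
    ‖G y‖ ^ 2 ≤ 2 * L ^ 2 * (1 + ‖y‖ ^ 2) := by
  have h1 : ‖G y‖ ^ 2 ≤ (L * (1 + ‖y‖)) ^ 2 :=
    pow_le_pow_left₀ (norm_nonneg _) (h.norm_G_le y) 2
  nlinarith [mul_nonneg (sq_nonneg L) (sq_nonneg (1 - ‖y‖))]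

end HilbertSchmidt

/-! ### The discrete propagator, the space `Ḣ^α` and the coefficients -/

section Coefficients

variable {H : Type*} [NormedAddCommGroup H] [InnerProductSpace ℝ H] [CompleteSpace H]

/-- At `z = 0` the bound follows from that on `(0, ∞)` by continuity. -/
theorem IsStableRational.abs_le_one {r : ℝ → ℝ} (hr : IsStableRational r) {z : ℝ} (hz : 0 ≤ z) :
    |r z| ≤ 1 := by
  rcases hz.eq_or_lt with rfl | hz
  · obtain ⟨p, d, h⟩ := hr.rational
    have hc : ContinuousAt (fun z => |p.eval z / d.eval z|) 0 :=
      (p.continuous.continuousAt.div d.continuous.continuousAt (h 0 le_rfl).1).abs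
    have ht : Tendsto (fun z => |p.eval z / d.eval z|) (𝓝[>] 0) (𝓝 |r 0|) := by
      rw [(h 0 le_rfl).2]
      exact hc.tendsto.mono_left nhdsWithin_le_nhds
    refine le_of_tendsto ht ?_
    filter_upwards [self_mem_nhdsWithin] with z hz
    rw [← (h z (le_of_lt hz)).2]
    exact (hr.abs_lt_one z hz).le
  · exact (hr.abs_lt_one z hz).le

namespace GalerkinSpace

variable {A : EllipticOperator H} {N : ℕ} (V : GalerkinSpace A N)

theorem ev_nonneg (n : Fin N) : 0 ≤ V.ev n := by
  set e := V.negDiscrete_isSymmetric.eigenvectorBasis V.finrank_eq n with he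
  have h := V.inner_negDiscrete e e
  have h2 : V.negDiscrete e = V.ev n • e :=
    V.negDiscrete_isSymmetric.apply_eigenvectorBasis V.finrank_eq n
  have h3 : inner ℝ e e = (1 : ℝ) := by
    rw [real_inner_self_eq_norm_sq, he, OrthonormalBasis.norm_eq_one, one_pow]
  rw [h2, real_inner_smul_left, h3, mul_one] at h
  rw [h]
  exact real_inner_self_nonneg

theorem orthonormal_ef : Orthonormal ℝ V.ef :=
  (V.negDiscrete_isSymmetric.eigenvectorBasis V.finrank_eq).orthonormal.comp_linearIsometry
    V.space.subtypeₗᵢ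

theorem inner_proj_ef (v : H) (n : Fin N) : inner ℝ (V.proj v) (V.ef n) = inner ℝ v (V.ef n) := by
  rw [proj, Submodule.inner_starProjection_left_eq_right]
  congr 1
  exact Submodule.starProjection_eq_self_iff.2 (Subtype.mem _)

theorem norm_proj_le (v : H) : ‖V.proj v‖ ≤ ‖v‖ := V.space.norm_starProjection_apply_le v

theorem ratApprox_proj (r : ℝ → ℝ) (h : ℝ) (v : H) :
    V.ratApprox r h (V.proj v) = V.ratApprox r h v := by
  simp only [ratApprox, inner_proj_ef]

theorem ratApprox_add (r : ℝ → ℝ) (h : ℝ) (v w : H) :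
    V.ratApprox r h (v + w) = V.ratApprox r h v + V.ratApprox r h w := by
  simp only [ratApprox, inner_add_left, mul_add, add_smul, Finset.sum_add_distrib]

theorem ratApprox_sub (r : ℝ → ℝ) (h : ℝ) (v w : H) :
    V.ratApprox r h (v - w) = V.ratApprox r h v - V.ratApprox r h w := by
  simp only [ratApprox, inner_sub_left, mul_sub, sub_smul, Finset.sum_sub_distrib]

theorem continuous_ratApprox (r : ℝ → ℝ) (h : ℝ) : Continuous (V.ratApprox r h) := by
  unfold ratApprox
  fun_prop

theorem norm_ratApprox_le {r : ℝ → ℝ} (hr : IsStableRational r) {h : ℝ} (hh : 0 ≤ h) (v : H) :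
    ‖V.ratApprox r h v‖ ≤ ‖v‖ := by
  refine le_of_sq_le_sq ?_ (norm_nonneg v)
  have h1 : ‖V.ratApprox r h v‖ ^ 2 = ∑ n, (r (h * V.ev n) * inner ℝ v (V.ef n)) ^ 2 := by
    rw [← real_inner_self_eq_norm_sq, ratApprox, V.orthonormal_ef.inner_sum]
    exact Finset.sum_congr rfl fun n _ => by simp; ring
  rw [h1]
  refine le_trans (Finset.sum_le_sum fun n _ => ?_)
    (V.orthonormal_ef.sum_inner_products_le (x := v) (s := Finset.univ))
  rw [mul_pow, Real.norm_eq_abs, sq_abs, real_inner_comm]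
  have h2 := hr.abs_le_one (mul_nonneg hh (V.ev_nonneg n))
  have h3 : r (h * V.ev n) ^ 2 ≤ 1 := by rw [← sq_abs]; exact pow_le_one₀ (abs_nonneg _) h2
  exact mul_le_of_le_one_left (sq_nonneg _) h3

theorem enorm_ratApprox_sq_le {r : ℝ → ℝ} (hr : IsStableRational r) {h : ℝ} (hh : 0 ≤ h) (v : H) :
    ‖V.ratApprox r h v‖ₑ ^ 2 ≤ ‖v‖ₑ ^ 2 := by
  rw [enorm_sq, enorm_sq]
  exact ENNReal.ofReal_le_ofReal
    (pow_le_pow_left₀ (norm_nonneg _) (V.norm_ratApprox_le hr hh v) 2)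

end GalerkinSpace

/-- `Ḣ^α` is continuously embedded in `H`, with the constant `λ₁^{-α/2}`. -/
theorem EllipticOperator.enorm_le_hdotENorm (A : EllipticOperator H) {α : ℝ} (hα : 0 ≤ α) :
    ∃ C : ℝ≥0, ∀ v, ‖v‖ₑ ≤ C * A.hdotENorm α v := by
  set κ : ℝ := A.ev 0 ^ (α / 2) with hκ
  have hκ0 : 0 < κ := Real.rpow_pos_of_pos (A.ev_pos 0) _
  refine ⟨κ⁻¹.toNNReal, fun v => ?_⟩
  have hC : 0 < κ⁻¹.toNNReal := Real.toNNReal_pos.2 (inv_pos.2 hκ0)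
  rw [hdotENorm]
  split_ifs with h
  · have key : ∀ x : H, HasSum (fun n => (inner ℝ (A.ef n) x) ^ 2) (‖x‖ ^ 2) := fun x => by
      have h := A.ef.hasSum_inner_mul_inner x x
      rw [real_inner_self_eq_norm_sq] at h
      refine h.congr_fun fun n => ?_
      rw [real_inner_comm, sq]
    set w := A.fracPow (α / 2) ⟨v, h⟩ with hw
    have h1 : (κ * ‖v‖) ^ 2 ≤ ‖w‖ ^ 2 := by
      rw [mul_pow]
      refine hasSum_le (fun n => ?_) ((key v).mul_left _) (key w)
      have e : inner ℝ (A.ef n) w = A.ev n ^ (α / 2) * inner ℝ (A.ef n) v :=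
        inner_diagPMap A.ef _ ⟨v, h⟩ n
      rw [e, mul_pow]
      refine mul_le_mul_of_nonneg_right (pow_le_pow_left₀ hκ0.le ?_ 2) (sq_nonneg _)
      exact Real.rpow_le_rpow (A.ev_pos 0).le (A.ev_mono (Nat.zero_le n)) (by positivity)
    have h2 : κ * ‖v‖ ≤ ‖w‖ := le_of_sq_le_sq h1 (norm_nonneg w)
    have h3 : (κ⁻¹.toNNReal : ℝ≥0∞) = ENNReal.ofReal κ⁻¹ := rfl
    rw [h3, ← ofReal_norm, ← ofReal_norm, ← ENNReal.ofReal_mul (inv_pos.2 hκ0).le]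
    refine ENNReal.ofReal_le_ofReal ?_
    rw [← div_eq_inv_mul, le_div_iff₀ hκ0]
    linarith
  · rw [ENNReal.mul_top (by exact_mod_cast hC.ne')]
    exact le_top

variable {U : Type*} [NormedAddCommGroup U] [InnerProductSpace ℝ U] [CompleteSpace U]
variable {q : Covariance U}

theorem CoefficientAssumption.exists_bounds {A : EllipticOperator H} {α : ℝ} {F : H → H}
    {G : H → q.HS H} (h : CoefficientAssumption A q α F G) :
    ∃ L : ℝ, CoefficientBounds q F G L := by
  obtain ⟨C₁, h₁⟩ := h.F_bound
  obtain ⟨C₂, h₂⟩ := h.G_bound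
  have f₁ : ∀ v, ‖fderiv ℝ F v‖ ≤ C₁ := fun v =>
    (le_add_of_nonneg_right (norm_nonneg (fderiv ℝ (fderiv ℝ F) v))).trans (h₁ v)
  have f₂ : ∀ v, ‖fderiv ℝ G v‖ ≤ C₂ := fun v =>
    (le_add_of_nonneg_right (norm_nonneg (fderiv ℝ (fderiv ℝ G) v))).trans (h₂ v)
  have l₁ : ∀ u v, ‖F u - F v‖ ≤ C₁ * ‖u - v‖ := fun u v =>
    convex_univ.norm_image_sub_le_of_norm_fderiv_le (fun x _ => h.F_diff x) (fun x _ => f₁ x)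
      (Set.mem_univ v) (Set.mem_univ u)
  have l₂ : ∀ u v, ‖G u - G v‖ ≤ C₂ * ‖u - v‖ := fun u v =>
    convex_univ.norm_image_sub_le_of_norm_fderiv_le (fun x _ => h.G_diff x) (fun x _ => f₂ x)
      (Set.mem_univ v) (Set.mem_univ u)
  have c₁ : 0 ≤ C₁ := (norm_nonneg _).trans (f₁ 0)
  have c₂ : 0 ≤ C₂ := (norm_nonneg _).trans (f₂ 0)
  have n₁ := norm_nonneg (F 0)
  have n₂ := norm_nonneg (G 0)
  refine ⟨C₁ + C₂ + ‖F 0‖ + ‖G 0‖, by positivity, fun u v => (l₁ u v).trans ?_,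
    fun u v => (l₂ u v).trans ?_, fun v => (f₂ v).trans (by linarith), fun v => ?_, fun v => ?_⟩
  · exact mul_le_mul_of_nonneg_right (by linarith) (norm_nonneg _)
  · exact mul_le_mul_of_nonneg_right (by linarith) (norm_nonneg _)
  · have a := l₁ v 0
    have b := norm_le_insert' (F v) (F 0)
    rw [sub_zero] at a
    have d := norm_nonneg v
    nlinarith [mul_nonneg c₂ d, mul_nonneg n₁ d, mul_nonneg n₂ d]
  · have a := l₂ v 0
    have b := norm_le_insert' (G v) (G 0)
    rw [sub_zero] at a
    have d := norm_nonneg v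
    nlinarith [mul_nonneg c₁ d, mul_nonneg n₁ d, mul_nonneg n₂ d]

end Coefficients

/-! ### The recursions of the two schemes -/

section Recursion

variable {Ω : Type*} {mΩ : MeasurableSpace Ω} {P : Measure Ω}
variable {U : Type*} [NormedAddCommGroup U] [InnerProductSpace ℝ U] [CompleteSpace U]
variable {H : Type*} [NormedAddCommGroup H] [InnerProductSpace ℝ H] [CompleteSpace H]
variable {q : Covariance U} {W : ℝ≥0 → Ω → U} {𝓕 : Filtration ℝ≥0 mΩ} {T : ℝ≥0}
variable {A : EllipticOperator H} {N : ℕ} {V : GalerkinSpace A N} {r : ℝ → ℝ} {α : ℝ}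
variable {F : H → H} {G : H → q.HS H} {X₀ : Ω → H}

/-- The coefficients `G'(y)(P_N G(y) (√ηₗ eₗ)) (√ηₖ eₖ)` of the Milstein correction. -/
def correctionCoeff (G : H → q.HS H) (V : GalerkinSpace A N) (k l : ℕ) (y : H) : H :=
  fderiv ℝ G y (V.proj (G y (q.basisVec l))) (q.basisVec k)

theorem grid_le {M m : ℕ} (hm : m ≤ M) : grid T M m ≤ T := by
  rcases Nat.eq_zero_or_pos M with rfl | hM
  · simp [grid]
  · rw [grid, ← mul_div_assoc]
    refine div_le_of_le_mul₀ (by positivity) (by positivity) ?_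
    rw [mul_comm]
    gcongr

theorem grid_mono (M : ℕ) : Monotone (grid T M) := fun m n h => by
  unfold grid
  gcongr

theorem grid_succ_sub (M m : ℕ) : ((grid T M (m + 1) : ℝ≥0) : ℝ) - grid T M m = T / M := by
  simp only [grid]
  push_cast
  ring

theorem milsteinCorrection_eq (M K m : ℕ) (y : H) (ω : Ω) :
    ∑ k : Fin K, incrementCoord q W (grid T M m) (grid T M (m + 1)) K ω k • G y (q.basisVec k) +
      milsteinCorrection q G V W T M K m y ω =
    stepNoise (T / M) K (fun k => G y (q.basisVec k)) (fun k l => correctionCoeff G V k l y)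
      (incrementCoord q W (grid T M m) (grid T M (m + 1)) K ω) := by
  simp only [milsteinCorrection, stepNoise, Finset.sum_range, Fin.ext_iff]
  rfl

theorem milstein_succ (M K m : ℕ) (ω : Ω) :
    milstein q F G V r W X₀ T M K (m + 1) ω = V.ratApprox r (T / M)
      (milstein q F G V r W X₀ T M K m ω + ((T : ℝ) / M) • F (milstein q F G V r W X₀ T M K m ω) +
        stepNoise (T / M) K (fun k => G (milstein q F G V r W X₀ T M K m ω) (q.basisVec k))
          (fun k l => correctionCoeff G V k l (milstein q F G V r W X₀ T M K m ω))
          (incrementCoord q W (grid T M m) (grid T M (m + 1)) K ω)) := by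
  rw [← milsteinCorrection_eq, ← apply_noiseIncrement, ← add_assoc]
  simp only [milstein, GalerkinSpace.ratApprox_proj]

theorem euler_succ (M K m : ℕ) (ω : Ω) :
    euler q F G V r W X₀ T M K (m + 1) ω = V.ratApprox r (T / M)
      (euler q F G V r W X₀ T M K m ω + ((T : ℝ) / M) • F (euler q F G V r W X₀ T M K m ω) +
        ∑ k : Fin K, incrementCoord q W (grid T M m) (grid T M (m + 1)) K ω k •
          G (euler q F G V r W X₀ T M K m ω) (q.basisVec k)) := by
  rw [← apply_noiseIncrement, GalerkinSpace.ratApprox_add, GalerkinSpace.ratApprox_add]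
  simp only [euler, GalerkinSpace.ratApprox_proj]

/-- The difference of the schemes satisfies a recursion of the same form, with Lipschitz
differences of `F` and `G` and with the whole Milstein correction as a perturbation. -/
theorem milstein_sub_euler_succ (M K m : ℕ) (ω : Ω) :
    milstein q F G V r W X₀ T M K (m + 1) ω - euler q F G V r W X₀ T M K (m + 1) ω =
      V.ratApprox r (T / M)
      (milstein q F G V r W X₀ T M K m ω - euler q F G V r W X₀ T M K m ω + ((T : ℝ) / M) •
          (F (milstein q F G V r W X₀ T M K m ω) - F (euler q F G V r W X₀ T M K m ω)) +
        stepNoise (T / M) K (fun k => (G (milstein q F G V r W X₀ T M K m ω) (q.basisVec k) -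
            G (euler q F G V r W X₀ T M K m ω) (q.basisVec k)))
          (fun k l => correctionCoeff G V k l (milstein q F G V r W X₀ T M K m ω))
          (incrementCoord q W (grid T M m) (grid T M (m + 1)) K ω)) := by
  rw [milstein_succ, euler_succ, ← GalerkinSpace.ratApprox_sub]
  congr 1
  simp only [stepNoise, smul_sub, Finset.sum_sub_distrib]
  abel

theorem CoefficientAssumption.continuous_correctionCoeff (h : CoefficientAssumption A q α F G)
    (V : GalerkinSpace A N) (k l : ℕ) : Continuous (correctionCoeff G V k l) :=
  (Covariance.HS.eval q H k).continuous.comp <|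
    h.G_diff₂.continuous.clm_apply
      (V.proj.continuous.comp (continuous_apply_basisVec h.G_diff.continuous l))

theorem correctionCoeff_eq_zero_left {k : ℕ} (hk : q.ev k = 0) (l : ℕ) (y : H) :
    correctionCoeff G V k l y = 0 := by
  rw [correctionCoeff, Covariance.basisVec_eq_zero hk, map_zero]

theorem correctionCoeff_eq_zero_right (k : ℕ) {l : ℕ} (hl : q.ev l = 0) (y : H) :
    correctionCoeff G V k l y = 0 := by
  rw [correctionCoeff, Covariance.basisVec_eq_zero hl, map_zero, map_zero, map_zero]
  simp

theorem sum_norm_correctionCoeff_sq_le {L : ℝ} {y : H} (hL : ‖fderiv ℝ G y‖ ≤ L) (n : ℕ) :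
    ∑ k ∈ Finset.range n, ∑ l ∈ Finset.range n, ‖correctionCoeff G V k l y‖ ^ 2 ≤
      L ^ 2 * ‖G y‖ ^ 2 := by
  rw [Finset.sum_comm]
  calc _ ≤ ∑ l ∈ Finset.range n, L ^ 2 * ‖G y (q.basisVec l)‖ ^ 2 := by
        refine Finset.sum_le_sum fun l _ => ?_
        refine (Covariance.HS.sum_norm_sq_le (fderiv ℝ G y (V.proj (G y (q.basisVec l)))) n).trans ?_
        rw [← mul_pow]
        refine pow_le_pow_left₀ (norm_nonneg _) ?_ 2
        refine (ContinuousLinearMap.le_opNorm _ _).trans ?_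
        exact mul_le_mul hL (V.norm_proj_le _) (norm_nonneg _) ((norm_nonneg _).trans hL)
    _ ≤ _ := by
        rw [← Finset.mul_sum]
        exact mul_le_mul_of_nonneg_left (Covariance.HS.sum_norm_sq_le _ n) (sq_nonneg L)

theorem CoefficientBounds.sum_norm_correctionCoeff_sq_le {L : ℝ} (h : CoefficientBounds q F G L)
    (V : GalerkinSpace A N) (y : H) (n : ℕ) :
    ∑ k ∈ Finset.range n, ∑ l ∈ Finset.range n, ‖correctionCoeff G V k l y‖ ^ 2 ≤
      2 * L ^ 4 * (1 + ‖y‖ ^ 2) := by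
  refine (SPDE.sum_norm_correctionCoeff_sq_le (h.norm_fderiv_G_le y) n).trans ?_
  nlinarith [mul_le_mul_of_nonneg_left (h.norm_G_sq_le y) (sq_nonneg L)]

variable [MeasurableSpace U]

theorem stronglyMeasurable_milstein (hW : IsWiener q 𝓕 P T W)
    (hX₀ : StronglyMeasurable[𝓕 0] X₀) (hFG : CoefficientAssumption A q α F G) (M K m : ℕ)
    (hm : m ≤ M) :
    StronglyMeasurable[𝓕 (grid T M m)] (milstein q F G V r W X₀ T M K m) := by
  induction m with
  | zero => exact (V.proj.continuous.comp_stronglyMeasurable hX₀).mono (𝓕.mono zero_le)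
  | succ m ih =>
    have h1 := (ih (by omega)).mono (𝓕.mono (grid_mono (T := T) M m.le_succ))
    have h2 := (measurable_incrementCoord hW (grid_mono M m.le_succ) (grid_le hm)
      K).stronglyMeasurable
    have hF := hFG.F_diff.continuous
    have hG := fun k => continuous_apply_basisVec hFG.G_diff.continuous k
    have hc := hFG.continuous_correctionCoeff V
    have hcont : Continuous fun p : H × (Fin K → ℝ) => V.ratApprox r (T / M)
        (p.1 + ((T : ℝ) / M) • F p.1 + stepNoise (T / M) K (fun k => G p.1 (q.basisVec k))
          (fun k l => correctionCoeff G V k l p.1) p.2) := by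
      refine (V.continuous_ratApprox r _).comp ?_
      exact (continuous_fst.add ((hF.comp continuous_fst).const_smul _)).add
        (continuous_stepNoise _ K hG hc)
    have h3 := hcont.comp_stronglyMeasurable (h1.prodMk h2)
    have e : milstein q F G V r W X₀ T M K (m + 1) = _ := funext (milstein_succ M K m)
    rw [e]
    exact h3

theorem stronglyMeasurable_euler (hW : IsWiener q 𝓕 P T W)
    (hX₀ : StronglyMeasurable[𝓕 0] X₀) (hFG : CoefficientAssumption A q α F G) (M K m : ℕ)
    (hm : m ≤ M) :
    StronglyMeasurable[𝓕 (grid T M m)] (euler q F G V r W X₀ T M K m) := by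
  induction m with
  | zero => exact (V.proj.continuous.comp_stronglyMeasurable hX₀).mono (𝓕.mono zero_le)
  | succ m ih =>
    have h1 := (ih (by omega)).mono (𝓕.mono (grid_mono (T := T) M m.le_succ))
    have h2 := (measurable_incrementCoord hW (grid_mono M m.le_succ) (grid_le hm)
      K).stronglyMeasurable
    have hF := hFG.F_diff.continuous
    have hG := fun k => continuous_apply_basisVec hFG.G_diff.continuous k
    have hcont : Continuous fun p : H × (Fin K → ℝ) => V.ratApprox r (T / M)
        (p.1 + ((T : ℝ) / M) • F p.1 + ∑ k : Fin K, p.2 k • G p.1 (q.basisVec k)) := by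
      refine (V.continuous_ratApprox r _).comp ?_
      exact (continuous_fst.add ((hF.comp continuous_fst).const_smul _)).add
        (continuous_finsetSum _ fun k _ => ((continuous_apply k).comp continuous_snd).smul
          ((hG k).comp continuous_fst))
    have h3 := hcont.comp_stronglyMeasurable (h1.prodMk h2)
    have e : euler q F G V r W X₀ T M K (m + 1) = _ := funext (euler_succ M K m)
    rw [e]
    exact h3

end Recursion

/-! ### Discrete Gronwall inequalities -/

section Gronwall

theorem gronwall_growth {u : ℕ → ℝ≥0∞} {κ : ℝ≥0∞} {M : ℕ}
    (hu : ∀ m < M, u (m + 1) ≤ u m + κ * (1 + u m)) {m : ℕ} (hm : m ≤ M) :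
    1 + u m ≤ (1 + κ) ^ m * (1 + u 0) := by
  induction m with
  | zero => simp
  | succ m ih =>
    calc 1 + u (m + 1) ≤ 1 + (u m + κ * (1 + u m)) := by gcongr; exact hu m (by omega)
      _ = (1 + κ) * (1 + u m) := by ring
      _ ≤ (1 + κ) * ((1 + κ) ^ m * (1 + u 0)) := by gcongr; exact ih (by omega)
      _ = _ := by ring

/-- The error `d` is forced by `ε (1 + u)`, where `u` itself grows at most geometrically. -/
theorem gronwall_forced {u d : ℕ → ℝ≥0∞} {κ ε : ℝ≥0∞} {M : ℕ}
    (hu : ∀ m < M, u (m + 1) ≤ u m + κ * (1 + u m))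
    (hd : ∀ m < M, d (m + 1) ≤ d m + κ * d m + ε * (1 + u m)) (hd₀ : d 0 = 0)
    {m : ℕ} (hm : m ≤ M) : d m ≤ (1 + κ) ^ m * (m * ε * (1 + u 0)) := by
  induction m with
  | zero => simp [hd₀]
  | succ m ih =>
    calc d (m + 1) ≤ d m + κ * d m + ε * (1 + u m) := hd m (by omega)
      _ = (1 + κ) * d m + ε * (1 + u m) := by ring
      _ ≤ (1 + κ) * ((1 + κ) ^ m * (m * ε * (1 + u 0))) + ε * ((1 + κ) ^ m * (1 + u 0)) := by
        gcongr
        · exact ih (by omega)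
        · exact gronwall_growth hu (by omega)
      _ ≤ (1 + κ) * ((1 + κ) ^ m * (m * ε * (1 + u 0))) +
          ε * ((1 + κ) ^ (m + 1) * (1 + u 0)) := by
        gcongr
        · exact le_self_add
        · omega
      _ = _ := by push_cast; ring

end Gronwall

/-! ### Eighth moments and the norm of `L⁸` -/

section Moments

theorem eLpNorm_eight_le {Ω : Type*} {mΩ : MeasurableSpace Ω} {P : Measure Ω} {E : Type*} [NormedAddCommGroup E] {f : Ω → E} {c : ℝ} (hc : 0 ≤ c)
    (h : lfour P (fun ω => ‖f ω‖ₑ ^ 2) ≤ ENNReal.ofReal c) :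
    eLpNorm f 8 P ≤ ENNReal.ofReal (Real.sqrt c) := by
  rw [lfour_le_iff] at h
  rw [eLpNorm_eq_lintegral_rpow_enorm_toReal (by norm_num) (by norm_num)]
  have e : ∀ ω, ‖f ω‖ₑ ^ (ENNReal.toReal 8) = (‖f ω‖ₑ ^ 2) ^ 4 := fun ω => by
    rw [← pow_mul, ← ENNReal.rpow_natCast]
    norm_num
  simp only [e]
  have h2 : (ENNReal.ofReal c) ^ 4 = (ENNReal.ofReal (Real.sqrt c)) ^ (8 : ℝ) := by
    have h3 : ENNReal.ofReal c = ENNReal.ofReal (Real.sqrt c) ^ 2 := by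
      rw [← ENNReal.ofReal_pow (Real.sqrt_nonneg _), Real.sq_sqrt hc]
    rw [h3, ← pow_mul, ← ENNReal.rpow_natCast]
    norm_num
  rw [h2] at h
  refine (ENNReal.rpow_le_rpow h (by positivity)).trans ?_
  rw [← ENNReal.rpow_mul]
  norm_num

theorem lfour_initial_lt_top {Ω : Type*} {mΩ : MeasurableSpace Ω} {P : Measure Ω}
    {H : Type*} [NormedAddCommGroup H] [InnerProductSpace ℝ H] [CompleteSpace H]
    {A : EllipticOperator H} {α : ℝ} {X₀ : Ω → H} (hα : 0 ≤ α)
    (hX₀_moment : ∫⁻ ω, A.hdotENorm α (X₀ ω) ^ 8 ∂P < ∞) :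
    lfour P (fun ω => ‖X₀ ω‖ₑ ^ 2) < ∞ := by
  obtain ⟨C, hC⟩ := A.enorm_le_hdotENorm hα
  refine ENNReal.rpow_lt_top_of_nonneg (by norm_num) (ne_of_lt ?_)
  calc _ ≤ ∫⁻ ω, (C : ℝ≥0∞) ^ 8 * A.hdotENorm α (X₀ ω) ^ 8 ∂P := by
        refine lintegral_mono fun ω => ?_
        rw [← pow_mul, ← mul_pow]
        exact pow_le_pow_left₀ zero_le (hC _) 8
    _ = (C : ℝ≥0∞) ^ 8 * ∫⁻ ω, A.hdotENorm α (X₀ ω) ^ 8 ∂P :=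
        lintegral_const_mul' _ _ (by simp)
    _ < ∞ := ENNReal.mul_lt_top (by simp) hX₀_moment

end Moments

/-! ### The distance between the Milstein and the Euler scheme -/

section Estimates

variable {Ω : Type*} {mΩ : MeasurableSpace Ω} {P : Measure Ω} [IsProbabilityMeasure P]
variable {U : Type*} [NormedAddCommGroup U] [InnerProductSpace ℝ U] [CompleteSpace U]
  [MeasurableSpace U] [BorelSpace U]
variable {H : Type*} [NormedAddCommGroup H] [InnerProductSpace ℝ H] [CompleteSpace H]
  [TopologicalSpace.SeparableSpace H]
variable {q : Covariance U} {W : ℝ≥0 → Ω → U} {𝓕 : Filtration ℝ≥0 mΩ} {T : ℝ≥0}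
variable {A : EllipticOperator H} {α : ℝ} {F : H → H} {G : H → q.HS H} {X₀ : Ω → H}
  {N : ℕ} {V : GalerkinSpace A N} {r : ℝ → ℝ}

/-- The growth constant of the one-step estimates, for coefficients with the bound `L`, step sizes
up to `T`, and the factor `κ` of the chaos estimate. -/
def stepConst (T L κ : ℝ) : ℝ :=
  4 * L + 2 * T * L ^ 2 + 2 * κ * L ^ 2 + 2 * κ * (T + 1) * L ^ 4

theorem stepConst_nonneg {T L κ : ℝ} (hT : 0 ≤ T) (hL : 0 ≤ L) (hκ : 0 ≤ κ) :
    0 ≤ stepConst T L κ := by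
  unfold stepConst
  positivity

/-- With `n = ‖y‖`, `x = ‖y + h F(y)‖` and the squared sizes `o`, `c` of the coefficients of the
noise, this is the growth of the squared norm over one Milstein step. -/
theorem moment_step_le {T L κ h n x o c : ℝ} (hT : 0 ≤ T) (hL : 0 ≤ L) (hκ : 0 ≤ κ) (hh : 0 ≤ h)
    (hhT : h ≤ T) (hx₀ : 0 ≤ x) (hx : x ≤ n + h * (L * (1 + n)))
    (ho : o ≤ 2 * L ^ 2 * (1 + n ^ 2)) (hc : c ≤ 2 * L ^ 4 * (1 + n ^ 2)) :
    x ^ 2 + κ * (h * o + h ^ 2 * c) ≤ n ^ 2 + stepConst T L κ * h * (1 + n ^ 2) := by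
  have h4 := pow_le_pow_left₀ hx₀ hx 2
  have h5 : κ * (h * o + h ^ 2 * c) ≤
      κ * (h * (2 * L ^ 2 * (1 + n ^ 2)) + (h * (T + 1)) * (2 * L ^ 4 * (1 + n ^ 2))) := by
    have h6 : h ^ 2 ≤ h * (T + 1) := by nlinarith
    calc κ * (h * o + h ^ 2 * c) ≤
          κ * (h * (2 * L ^ 2 * (1 + n ^ 2)) + h ^ 2 * (2 * L ^ 4 * (1 + n ^ 2))) := by gcongr
      _ ≤ _ := by gcongr
  have h7 : (n + h * (L * (1 + n))) ^ 2 ≤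
      n ^ 2 + h * ((4 * L + 2 * T * L ^ 2) * (1 + n ^ 2)) := by
    have e1 : n * (1 + n) ≤ 2 * (1 + n ^ 2) := by nlinarith [sq_nonneg (n - 1)]
    have e2 : (1 + n) ^ 2 ≤ 2 * (1 + n ^ 2) := by nlinarith [sq_nonneg (n - 1)]
    have e3 : h * L * (n * (1 + n)) ≤ h * L * (2 * (1 + n ^ 2)) := by gcongr
    have e4 : h * h * L ^ 2 * (1 + n) ^ 2 ≤ h * T * L ^ 2 * (2 * (1 + n ^ 2)) := by gcongr
    linarith
  calc _ ≤ n ^ 2 + h * ((4 * L + 2 * T * L ^ 2) * (1 + n ^ 2)) +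
        κ * (h * (2 * L ^ 2 * (1 + n ^ 2)) + (h * (T + 1)) * (2 * L ^ 4 * (1 + n ^ 2))) :=
        add_le_add (h4.trans h7) h5
    _ = _ := by unfold stepConst; ring

/-- With `n = ‖y‖` and the distance `d` of the two schemes, this is the growth of the squared
distance over one step. The Milstein correction enters with the factor `h ^ 2`. -/
theorem error_step_le {T L κ h n d x o c : ℝ} (hT : 0 ≤ T) (hL : 0 ≤ L) (hκ : 0 ≤ κ) (hh : 0 ≤ h)
    (hhT : h ≤ T) (hx₀ : 0 ≤ x) (hx : x ≤ d + h * (L * d))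
    (ho : o ≤ L ^ 2 * d ^ 2) (hc : c ≤ 2 * L ^ 4 * (1 + n ^ 2)) :
    x ^ 2 + κ * (h * o + h ^ 2 * c) ≤
      d ^ 2 + stepConst T L κ * h * d ^ 2 + stepConst T L κ * h ^ 2 * (1 + n ^ 2) := by
  have h4 := pow_le_pow_left₀ hx₀ hx 2
  have h5 : κ * (h * o + h ^ 2 * c) ≤
      κ * (h * (L ^ 2 * d ^ 2) + h ^ 2 * (2 * L ^ 4 * (1 + n ^ 2))) := by
    gcongr
  have h7 : (d + h * (L * d)) ^ 2 ≤ d ^ 2 + (2 * L + T * L ^ 2) * h * d ^ 2 := by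
    have e4 : h * h * L ^ 2 * d ^ 2 ≤ h * T * L ^ 2 * d ^ 2 := by gcongr
    linarith
  have h8 : (2 * L + T * L ^ 2 + κ * L ^ 2) * (h * d ^ 2) ≤
      stepConst T L κ * (h * d ^ 2) := by
    refine mul_le_mul_of_nonneg_right ?_ (by positivity)
    have p1 : 0 ≤ 2 * L + T * L ^ 2 + κ * L ^ 2 + 2 * κ * (T + 1) * L ^ 4 := by positivity
    unfold stepConst
    linarith
  have h9 : (2 * κ * L ^ 4) * (h ^ 2 * (1 + n ^ 2)) ≤
      stepConst T L κ * (h ^ 2 * (1 + n ^ 2)) := by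
    refine mul_le_mul_of_nonneg_right ?_ (by positivity)
    have p1 : 0 ≤ 4 * L + 2 * T * L ^ 2 + 2 * κ * L ^ 2 + 2 * κ * T * L ^ 4 := by positivity
    unfold stepConst
    linarith
  linarith

theorem lfour_milstein_succ_le {C : ℝ≥0} (hC : IsSmoothnessConst H C)
    (hW : IsWiener q 𝓕 P T W) (hX₀ : StronglyMeasurable[𝓕 0] X₀)
    (hFG : CoefficientAssumption A q α F G) {L : ℝ} (hL : CoefficientBounds q F G L)
    (hr : IsStableRational r) {M m : ℕ} (K : ℕ) (hm : m < M) :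
    lfour P (fun ω => ‖milstein q F G V r W X₀ T M K (m + 1) ω‖ₑ ^ 2) ≤
      lfour P (fun ω => ‖milstein q F G V r W X₀ T M K m ω‖ₑ ^ 2) +
        ENNReal.ofReal (stepConst T L (C ^ 2) * (T / M)) *
          (1 + lfour P (fun ω => ‖milstein q F G V r W X₀ T M K m ω‖ₑ ^ 2)) := by
  set h : ℝ := T / M with hh
  have hh0 : 0 ≤ h := by positivity
  have hhT : h ≤ T := div_le_self T.2 (by exact_mod_cast (by omega : 1 ≤ M))
  have hB0 : 0 ≤ stepConst T L (C ^ 2) := stepConst_nonneg T.2 hL.nonneg (by positivity)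
  let _ : MeasurableSpace H := borel H
  have _ : BorelSpace H := ⟨rfl⟩
  have _ : SecondCountableTopology H := UniformSpace.secondCountable_of_separable H
  have mY : StronglyMeasurable[𝓕 (grid T M m)] (milstein q F G V r W X₀ T M K m) :=
    stronglyMeasurable_milstein hW hX₀ hFG M K m hm.le
  have cF := hFG.F_diff.continuous
  have st := lfour_step_le (T := T) (P := P) hC hW (grid_mono M m.le_succ) (grid_le hm) K
    mY.measurable
    (x := fun y => y + h • F y) (o := fun k y => G y (q.basisVec k)) (c := correctionCoeff G V)
    (by fun_prop) (fun k => continuous_apply_basisVec hFG.G_diff.continuous k)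
    (hFG.continuous_correctionCoeff V)
    (fun k hk e => by rw [Covariance.basisVec_eq_zero hk, map_zero])
    (fun k l hk e => correctionCoeff_eq_zero_left hk l e)
    (fun k l hl e => correctionCoeff_eq_zero_right k hl e)
  rw [Nat.succ_eq_add_one, grid_succ_sub, ← hh] at st
  refine (lfour_mono fun ω => ?_).trans (st.trans ?_)
  · rw [milstein_succ]
    exact V.enorm_ratApprox_sq_le hr hh0 _
  have aY : AEMeasurable (fun ω => ‖milstein q F G V r W X₀ T M K m ω‖ₑ ^ 2) P :=
    ((mY.mono (𝓕.le _)).enorm.pow_const 2).aemeasurable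
  generalize milstein q F G V r W X₀ T M K m = Y at *
  calc _ ≤ lfour P (fun ω => ‖Y ω‖ₑ ^ 2 +
          ENNReal.ofReal (stepConst T L (C ^ 2) * h) * (1 + ‖Y ω‖ₑ ^ 2)) := by
        refine lfour_mono fun ω => ?_
        rw [enorm_sq, ← ENNReal.ofReal_one, ← ENNReal.ofReal_add zero_le_one (by positivity),
          ← ENNReal.ofReal_mul (by positivity), ← ENNReal.ofReal_add (by positivity)
          (by positivity)]
        refine ENNReal.ofReal_le_ofReal (moment_step_le T.2 hL.nonneg (by positivity) hh0 hhT
          (norm_nonneg _) ?_ ((Covariance.HS.sum_norm_sq_le _ K).trans (hL.norm_G_sq_le _))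
          (hL.sum_norm_correctionCoeff_sq_le V _ K))
        refine (norm_add_le _ _).trans ?_
        rw [norm_smul, Real.norm_of_nonneg hh0]
        gcongr
        exact hL.norm_F_le _
    _ ≤ _ := by
        refine (lfour_add_le aY (by fun_prop)).trans ?_
        gcongr
        rw [lfour_const_mul (by fun_prop)]
        gcongr
        refine (lfour_add_le (by fun_prop) aY).trans ?_
        rw [lfour_const]

/-- The correction is of order `h` in `L⁸` and centred given the past, so that it adds a term of order
`h ^ 2`, and not `h`, to the squared distance of the schemes. -/
theorem lfour_milstein_sub_euler_succ_le {C : ℝ≥0} (hC : IsSmoothnessConst H C)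
    (hW : IsWiener q 𝓕 P T W) (hX₀ : StronglyMeasurable[𝓕 0] X₀)
    (hFG : CoefficientAssumption A q α F G) {L : ℝ} (hL : CoefficientBounds q F G L)
    (hr : IsStableRational r) {M m : ℕ} (K : ℕ) (hm : m < M) :
    lfour P (fun ω => ‖milstein q F G V r W X₀ T M K (m + 1) ω -
        euler q F G V r W X₀ T M K (m + 1) ω‖ₑ ^ 2) ≤
      lfour P (fun ω => ‖milstein q F G V r W X₀ T M K m ω -
          euler q F G V r W X₀ T M K m ω‖ₑ ^ 2) +
        ENNReal.ofReal (stepConst T L (C ^ 2) * (T / M)) *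
          lfour P (fun ω => ‖milstein q F G V r W X₀ T M K m ω -
            euler q F G V r W X₀ T M K m ω‖ₑ ^ 2) +
        ENNReal.ofReal (stepConst T L (C ^ 2) * (T / M) ^ 2) *
          (1 + lfour P (fun ω => ‖milstein q F G V r W X₀ T M K m ω‖ₑ ^ 2)) := by
  set h : ℝ := T / M with hh
  have hh0 : 0 ≤ h := by positivity
  have hhT : h ≤ T := div_le_self T.2 (by exact_mod_cast (by omega : 1 ≤ M))
  have hB0 : 0 ≤ stepConst T L (C ^ 2) := stepConst_nonneg T.2 hL.nonneg (by positivity)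
  let _ : MeasurableSpace H := borel H
  have _ : BorelSpace H := ⟨rfl⟩
  have _ : SecondCountableTopology H := UniformSpace.secondCountable_of_separable H
  have mY : StronglyMeasurable[𝓕 (grid T M m)] (milstein q F G V r W X₀ T M K m) :=
    stronglyMeasurable_milstein hW hX₀ hFG M K m hm.le
  have mZ : StronglyMeasurable[𝓕 (grid T M m)] (euler q F G V r W X₀ T M K m) :=
    stronglyMeasurable_euler hW hX₀ hFG M K m hm.le
  have cF := hFG.F_diff.continuous
  have cG := fun k => continuous_apply_basisVec hFG.G_diff.continuous k
  have st := lfour_step_le (T := T) (P := P) hC hW (grid_mono M m.le_succ) (grid_le hm) K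
    (mY.measurable.prodMk mZ.measurable)
    (x := fun y => y.1 - y.2 + h • (F y.1 - F y.2))
    (o := fun k y => G y.1 (q.basisVec k) - G y.2 (q.basisVec k))
    (c := fun k l y => correctionCoeff G V k l y.1)
    (by fun_prop) (fun k => ((cG k).comp continuous_fst).sub ((cG k).comp continuous_snd))
    (fun k l => (hFG.continuous_correctionCoeff V k l).comp continuous_fst)
    (fun k hk e => by rw [Covariance.basisVec_eq_zero hk, map_zero, map_zero, sub_zero])
    (fun k l hk e => correctionCoeff_eq_zero_left hk l e.1)
    (fun k l hl e => correctionCoeff_eq_zero_right k hl e.1)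
  rw [Nat.succ_eq_add_one, grid_succ_sub, ← hh] at st
  refine (lfour_mono fun ω => ?_).trans (st.trans ?_)
  · rw [milstein_sub_euler_succ]
    exact V.enorm_ratApprox_sq_le hr hh0 _
  have aY : AEMeasurable (fun ω => ‖milstein q F G V r W X₀ T M K m ω‖ₑ ^ 2) P :=
    ((mY.mono (𝓕.le _)).enorm.pow_const 2).aemeasurable
  have aD : AEMeasurable (fun ω => ‖milstein q F G V r W X₀ T M K m ω -
      euler q F G V r W X₀ T M K m ω‖ₑ ^ 2) P :=
    (((mY.mono (𝓕.le _)).sub (mZ.mono (𝓕.le _))).enorm.pow_const 2).aemeasurable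
  generalize milstein q F G V r W X₀ T M K m = Y at *
  generalize euler q F G V r W X₀ T M K m = Z at *
  calc _ ≤ lfour P (fun ω => (‖Y ω - Z ω‖ₑ ^ 2 +
          ENNReal.ofReal (stepConst T L (C ^ 2) * h) * ‖Y ω - Z ω‖ₑ ^ 2) +
          ENNReal.ofReal (stepConst T L (C ^ 2) * h ^ 2) * (1 + ‖Y ω‖ₑ ^ 2)) := by
        refine lfour_mono fun ω => ?_
        rw [enorm_sq, enorm_sq, ← ENNReal.ofReal_one,
          ← ENNReal.ofReal_add zero_le_one (by positivity),
          ← ENNReal.ofReal_mul (by positivity), ← ENNReal.ofReal_mul (by positivity),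
          ← ENNReal.ofReal_add (by positivity) (by positivity),
          ← ENNReal.ofReal_add (by positivity) (by positivity)]
        refine ENNReal.ofReal_le_ofReal (error_step_le T.2 hL.nonneg (by positivity) hh0 hhT
          (norm_nonneg _) ?_ ?_ (hL.sum_norm_correctionCoeff_sq_le V _ K))
        · refine (norm_add_le _ _).trans ?_
          rw [norm_smul, Real.norm_of_nonneg hh0]
          gcongr
          exact hL.F_lip _ _
        · refine (Covariance.HS.sum_norm_sq_le (G (Y ω) - G (Z ω)) K).trans ?_
          rw [← mul_pow]
          exact pow_le_pow_left₀ (norm_nonneg _) (hL.G_lip _ _) 2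
    _ ≤ _ := by
        refine (lfour_add_le (by fun_prop) (by fun_prop)).trans ?_
        gcongr
        · refine (lfour_add_le aD (by fun_prop)).trans ?_
          rw [lfour_const_mul (by fun_prop)]
        · rw [lfour_const_mul (by fun_prop)]
          gcongr
          refine (lfour_add_le (by fun_prop) aY).trans ?_
          rw [lfour_const]

/-- The two schemes differ by `O(M^{-1/2})` in `L⁸`, uniformly in `N`, `K` and the time step. -/
theorem exists_milstein_sub_euler_bound (hW : IsWiener q 𝓕 P T W)
    (hX₀ : StronglyMeasurable[𝓕 0] X₀) (hα : 0 ≤ α)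
    (hX₀_moment : ∫⁻ ω, A.hdotENorm α (X₀ ω) ^ 8 ∂P < ∞)
    (hFG : CoefficientAssumption A q α F G) :
    ∃ D : ℝ, 0 ≤ D ∧ ∀ {N : ℕ} (V : GalerkinSpace A N) (r : ℝ → ℝ), IsStableRational r →
      ∀ M K m : ℕ, 1 ≤ M → m ≤ M →
      eLpNorm (fun ω => milstein q F G V r W X₀ T M K m ω - euler q F G V r W X₀ T M K m ω) 8 P ≤
        ENNReal.ofReal (D * (M : ℝ) ^ (-(1 / 2) : ℝ)) := by
  obtain ⟨C, hC⟩ := exists_isSmoothnessConst H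
  obtain ⟨L, hL⟩ := hFG.exists_bounds
  set B := stepConst T L (C ^ 2)
  have hB : 0 ≤ B := stepConst_nonneg T.2 hL.nonneg (by positivity)
  set I := (lfour P (fun ω => ‖X₀ ω‖ₑ ^ 2)).toReal with hI
  have hI' : lfour P (fun ω => ‖X₀ ω‖ₑ ^ 2) = ENNReal.ofReal I :=
    (ENNReal.ofReal_toReal (lfour_initial_lt_top hα hX₀_moment).ne).symm
  have hI0 : 0 ≤ I := ENNReal.toReal_nonneg
  set E : ℝ := Real.exp (B * T) * (B * T ^ 2 * (1 + I)) with hE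
  have hE0 : 0 ≤ E := by positivity
  refine ⟨Real.sqrt E, Real.sqrt_nonneg _, fun {N} V r hr M K m hM hm => ?_⟩
  have hM0 : (0 : ℝ) < M := by exact_mod_cast hM
  -- The schemes start from the same value, so the squared distance after `m ≤ M` steps is at most
  -- `(1 + B T / M) ^ M * M * B (T / M) ^ 2 * (1 + I)`, which is `O(1 / M)`.
  have g := gronwall_forced (M := M)
    (u := fun m => lfour P (fun ω => ‖milstein q F G V r W X₀ T M K m ω‖ₑ ^ 2))
    (d := fun m => lfour P (fun ω => ‖milstein q F G V r W X₀ T M K m ω -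
      euler q F G V r W X₀ T M K m ω‖ₑ ^ 2))
    (fun m hm => lfour_milstein_succ_le (V := V) hC hW hX₀ hFG hL hr K hm)
    (fun m hm => lfour_milstein_sub_euler_succ_le (V := V) hC hW hX₀ hFG hL hr K hm)
    (by simp [milstein, euler, lfour_const]) hm
  have e : Real.sqrt E * (M : ℝ) ^ (-(1 / 2) : ℝ) = Real.sqrt (E / M) := by
    rw [Real.sqrt_div hE0, Real.sqrt_eq_rpow M, Real.rpow_neg hM0.le,
      div_eq_mul_inv (Real.sqrt E)]
  rw [e]
  refine eLpNorm_eight_le (by positivity) (g.trans ?_)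
  have i0 : lfour P (fun ω => ‖milstein q F G V r W X₀ T M K 0 ω‖ₑ ^ 2) ≤ ENNReal.ofReal I := by
    rw [← hI']
    refine lfour_mono fun ω => pow_le_pow_left₀ zero_le ?_ 2
    rw [← ofReal_norm, ← ofReal_norm]
    exact ENNReal.ofReal_le_ofReal (V.norm_proj_le _)
  have p0 : (1 + ENNReal.ofReal (B * (T / M))) ^ m ≤ ENNReal.ofReal (Real.exp (B * T)) := by
    rw [← ENNReal.ofReal_one, ← ENNReal.ofReal_add zero_le_one (by positivity),
      ← ENNReal.ofReal_pow (by positivity)]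
    refine ENNReal.ofReal_le_ofReal ?_
    calc (1 + B * (T / M)) ^ m ≤ (1 + B * (T / M)) ^ M :=
          pow_le_pow_right₀ (le_add_of_nonneg_right (by positivity)) hm
      _ ≤ (Real.exp (B * (T / M))) ^ M := by
          gcongr
          rw [add_comm]
          exact Real.add_one_le_exp _
      _ = _ := by
          rw [← Real.exp_nat_mul]
          congr 1
          field_simp
  have hmM : (m : ℝ≥0∞) ≤ ENNReal.ofReal M := by
    rw [ENNReal.ofReal_natCast]
    exact_mod_cast hm
  calc _ ≤ ENNReal.ofReal (Real.exp (B * T)) * (ENNReal.ofReal M * ENNReal.ofReal (B * (T / M) ^ 2)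
        * (ENNReal.ofReal 1 + ENNReal.ofReal I)) := by
        rw [ENNReal.ofReal_one]
        gcongr
    _ = ENNReal.ofReal (E / M) := by
        rw [← ENNReal.ofReal_add zero_le_one hI0, ← ENNReal.ofReal_mul hM0.le,
          ← ENNReal.ofReal_mul (by positivity), ← ENNReal.ofReal_mul (by positivity)]
        congr 1
        rw [hE]
        field_simp

end Estimates

end SPDE

end

theorem corollary3p3
    {H U Ω : Type*}
    [NormedAddCommGroup H] [InnerProductSpace ℝ H] [CompleteSpace H]
    [TopologicalSpace.SeparableSpace H]
    [NormedAddCommGroup U] [InnerProductSpace ℝ U] [CompleteSpace U]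
    [TopologicalSpace.SeparableSpace U] [MeasurableSpace U] [BorelSpace U]
    {mΩ : MeasurableSpace Ω} (P : Measure Ω) [IsProbabilityMeasure P]
    (𝓕 : Filtration ℝ≥0 mΩ) (h𝓕 : SPDE.IsNormalFiltration 𝓕 P)
    (T : ℝ≥0) (hT : 0 < T)
    (A : SPDE.EllipticOperator H)
    (q : SPDE.Covariance U) (W : ℝ≥0 → Ω → U) (hW : SPDE.IsWiener q 𝓕 P T W)
    (α : ℝ) (hα : 1 ≤ α)
    (X₀ : Ω → H) (hX₀ : StronglyMeasurable[𝓕 0] X₀)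
    (hX₀_moment : ∫⁻ ω, A.hdotENorm α (X₀ ω) ^ 8 ∂P < ∞)
    (F : H → H) (G : H → q.HS H) (hFG : SPDE.CoefficientAssumption A q α F G)
    (X : ℝ≥0 → Ω → H) (hX : SPDE.IsMildSolution A q 𝓕 P T W X₀ F G X)
    (V : ∀ N : ℕ, SPDE.GalerkinSpace A N)
    (r : ℝ → ℝ) (hr : SPDE.IsStableRational r)
    (a β : ℝ) (ha : 0 < a) (hβ : 0 < β)
    (hEuler : ∃ C : ℝ, 0 < C ∧ SPDE.StrongErrorBound P T X
      (fun M N K => SPDE.euler q F G (V N) r W X₀ T M K) C a β) :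
    ∃ C : ℝ, 0 < C ∧ SPDE.StrongErrorBound P T X
      (fun M N K => SPDE.milstein q F G (V N) r W X₀ T M K) C a β := by
  obtain ⟨C, hC, hE⟩ := hEuler
  obtain ⟨D, hD, hYZ⟩ := SPDE.exists_milstein_sub_euler_bound hW hX₀ (by linarith : 0 ≤ α)
    hX₀_moment hFG
  refine ⟨C + D, by positivity, fun p hp hp8 M N K hM hN hK m hm => ?_⟩
  have mX : AEStronglyMeasurable (X (SPDE.grid T M m)) P :=
    ((hX.predictable.stronglyAdapted (SPDE.grid T M m)).mono (𝓕.le _)).aestronglyMeasurable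
  have mY : AEStronglyMeasurable (SPDE.milstein q F G (V N) r W X₀ T M K m) P :=
    ((SPDE.stronglyMeasurable_milstein hW hX₀ hFG M K m hm).mono (𝓕.le _)).aestronglyMeasurable
  have mZ : AEStronglyMeasurable (SPDE.euler q F G (V N) r W X₀ T M K m) P :=
    ((SPDE.stronglyMeasurable_euler hW hX₀ hFG M K m hm).mono (𝓕.le _)).aestronglyMeasurable
  have h8 : ENNReal.ofReal p ≤ 8 := by
    rw [show (8 : ℝ≥0∞) = ENNReal.ofReal 8 by norm_num]
    exact ENNReal.ofReal_le_ofReal hp8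
  -- The norms of `L^p` increase with `p`, so that `p = 8` suffices; this also covers `p < 1`, where
  -- there is no triangle inequality.
  refine (eLpNorm_le_eLpNorm_of_exponent_le h8 (mX.sub mY)).trans ?_
  have e8 := hE 8 (by norm_num) le_rfl M N K hM hN hK m hm
  rw [show ENNReal.ofReal 8 = (8 : ℝ≥0∞) by norm_num] at e8
  have tri := eLpNorm_sub_le (μ := P) (p := 8) (mX.sub mZ) (mY.sub mZ) (by norm_num)
  have d8 := hYZ (V N) r hr M K m hM hm
  have eq : (X (SPDE.grid T M m) - SPDE.euler q F G (V N) r W X₀ T M K m) -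
      (SPDE.milstein q F G (V N) r W X₀ T M K m - SPDE.euler q F G (V N) r W X₀ T M K m) =
      fun ω => X (SPDE.grid T M m) ω - SPDE.milstein q F G (V N) r W X₀ T M K m ω := by
    funext ω
    simp
  rw [eq] at tri
  refine tri.trans ((add_le_add e8 d8).trans ?_)
  rw [← ENNReal.ofReal_add (by positivity) (by positivity)]
  refine ENNReal.ofReal_le_ofReal ?_
  have p1 : 0 ≤ (N : ℝ) ^ (-a) := by positivity
  have p2 : 0 ≤ (K : ℝ) ^ (-β) := by positivity
  nlinarith
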